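/- **Corollary.** There exist asymptotically good codes over $\mathbb{F}_q$ with a one-pass, $O(\log n)$-space randomized error detector, both for $q=2$ and for $n\le q\le \mathrm{poly}(n)$. *Notions.* A linear code $C\subseteq\mathbb{F}_q^n$ has rate $\dim(C)/n$; its relative distance is at least $\delta$ if any two distinct codewords differ in at least $\delta n$ positions. For $y\in\mathbb{F}_q^n$ let $\Delta(y,C)$ be the smallest Hamming distance from $y$ to a codeword. An $(r,s)_{c,d}$-error detector for $C$ is a randomized algorithm that, on every input $y\in\mathbb{F}_q^n$ presented as a data stream and for all outcomes of its coin tosses, halts, makes at most $r$ passes over $y$ and uses at most $s$ bits of work space; it accepts $y$ with probability at least $c$ if $y\in C$, and with probability at most $d$ if $y\notin C$ (that is, if $\Delta(y,C)\ge 1$). Algorithms are programs with a fixed finite number of registers holding natural numbers, with instructions for integer arithmetic, branching and loops, for reading the next letter of the stream, and for tossing a fair coin; space is the total binary length of the registers. One fixed program serves the whole family of codes: its registers initially contain the parameters (given below), and each letter of the stream is given as a natural number below $q$. *Statement.* 1. ($q=2$.) There are constants $R,\delta>0$ and $K$, linear codes $C_n\subseteq\mathbb{F}_2^n$ for all $n\ge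 1$, and one program that, given the parameter $n$, is for every $n\ge1$ a $(1,\,K(\lfloor\log_2 n\rfloor+1))_{1,1/2}$-error detector for $C_n$, where $C_n$ has rate at least $R$ and relative distance at least $\delta$. 2. ($n\le q\le\mathrm{poly}(n)$.) Let $\mathbb{F}_q$ be given as $\mathbb{F}_p[X]/(f)$ with $p$ prime, $f$ monic irreducible and $q=p^{\deg f}$; a polynomial $\sum_i a_iX^i$ with $0\le a_i<p$ is written as the number $\sum_i a_ip^i$, and a field element as the number of its representative of degree less than $\deg f$. There are constants $R,\delta>0$, linear codes $C_{n,p,f}\subseteq\mathbb{F}_q^n$, and one program, such that for every $c\in\mathbb{N}$ there is a constant $K$ (depending on $c$) with the following property: for all $n\ge 1$ and all $p,f$ as above with $n\le q\le c\,n^c$, the code $C_{n,p,f}$ has rate at least $R$ and relative distance at least $\delta$, and the program, given the parameters $n,p,f$, is a $(1,\,K(\lfloor\log_2 n\rfloor+1))_{1,1/2}$-error detector for $C_{n,p,f}$. -/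

import Mathlib

/-! ## Randomized data stream algorithms

The machine model: a WHILE program over a fixed finite number of registers that hold natural
numbers, with an instruction that reads the next letter of the data stream (there is no way to go
back) and an instruction that tosses a fair coin (a coin can be seen again only if its value was
stored in a register).  Space is counted in bits: the total binary length of all the registers,
the ones that hold the parameters of the problem included. -/

/-- Arithmetic expressions in the registers.  Subtraction is truncated, division is integer
division.  (A fixed expression is evaluated in space linear in the space of the registers.) -/
inductive StreamExpr (k : ℕ) : Type
  | reg (i : Fin k)
  | const (a : ℕ)
  | add (e₁ e₂ : StreamExpr k)
  | sub (e₁ e₂ : StreamExpr k)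
  | mul (e₁ e₂ : StreamExpr k)
  | div (e₁ e₂ : StreamExpr k)
  | mod (e₁ e₂ : StreamExpr k)

/-- The value of an expression. -/
def StreamExpr.eval {k : ℕ} (v : Fin k → ℕ) : StreamExpr k → ℕ
  | .reg i => v i
  | .const a => a
  | .add e₁ e₂ => e₁.eval v + e₂.eval v
  | .sub e₁ e₂ => e₁.eval v - e₂.eval v
  | .mul e₁ e₂ => e₁.eval v * e₂.eval v
  | .div e₁ e₂ => e₁.eval v / e₂.eval v
  | .mod e₁ e₂ => e₁.eval v % e₂.eval v

/-- Programs with `k` registers.  A guard holds when its value is not `0`. -/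
inductive StreamProg (k : ℕ) : Type
  | skip
  | assign (i : Fin k) (e : StreamExpr k)
  /-- put the next letter of the stream into register `i` -/
  | read (i : Fin k)
  /-- put the outcome (`0` or `1`) of a fair coin toss into register `i` -/
  | toss (i : Fin k)
  | seq (P Q : StreamProg k)
  | ite (e : StreamExpr k) (P Q : StreamProg k)
  | while (e : StreamExpr k) (P : StreamProg k)

/-- A configuration: the registers, the part of the stream that has not been read yet, and the
outcomes of the coins that have not been tossed yet. -/
structure StreamState (k : ℕ) : Type where
  regs : Fin k → ℕ
  stream : List ℕ
  coins : List Bool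

/-- The space in bits that is in use: the total binary length of the registers. -/
def StreamState.space {k : ℕ} (σ : StreamState k) : ℕ := ∑ i, (σ.regs i).size

/-- Overwrite register `i` by `a`. -/
def StreamState.set {k : ℕ} (σ : StreamState k) (i : Fin k) (a : ℕ) : StreamState k :=
  { σ with regs := Function.update σ.regs i a }

/-- `StreamRun s P σ τ`: started in `σ`, the program `P` halts in `τ`, and it uses at most `s` bits
of space at every moment.  Reading beyond the end of the stream yields `0`; tossing a coin when no
coin is left has no rule, so that such a run does not count as halting. -/
inductive StreamRun {k : ℕ} (s : ℕ) : StreamProg k → StreamState k → StreamState k → Prop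
  | skip {σ : StreamState k} (h : σ.space ≤ s) : StreamRun s .skip σ σ
  | assign {σ : StreamState k} {i : Fin k} {e : StreamExpr k} (h : σ.space ≤ s)
      (h' : (σ.set i (e.eval σ.regs)).space ≤ s) :
      StreamRun s (.assign i e) σ (σ.set i (e.eval σ.regs))
  | readLetter {σ : StreamState k} {i : Fin k} {a : ℕ} {l : List ℕ} (h : σ.space ≤ s)
      (hl : σ.stream = a :: l) (h' : (σ.set i a).space ≤ s) :
      StreamRun s (.read i) σ { σ.set i a with stream := l }
  | readEnd {σ : StreamState k} {i : Fin k} (h : σ.space ≤ s)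
      (hl : σ.stream = []) (h' : (σ.set i 0).space ≤ s) :
      StreamRun s (.read i) σ (σ.set i 0)
  | toss {σ : StreamState k} {i : Fin k} {b : Bool} {l : List Bool} (h : σ.space ≤ s)
      (hl : σ.coins = b :: l) (h' : (σ.set i b.toNat).space ≤ s) :
      StreamRun s (.toss i) σ { σ.set i b.toNat with coins := l }
  | seq {σ τ ρ : StreamState k} {P Q : StreamProg k} (hP : StreamRun s P σ τ)
      (hQ : StreamRun s Q τ ρ) : StreamRun s (.seq P Q) σ ρ
  | iteTrue {σ τ : StreamState k} {e : StreamExpr k} {P Q : StreamProg k}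
      (he : e.eval σ.regs ≠ 0) (hP : StreamRun s P σ τ) : StreamRun s (.ite e P Q) σ τ
  | iteFalse {σ τ : StreamState k} {e : StreamExpr k} {P Q : StreamProg k}
      (he : e.eval σ.regs = 0) (hQ : StreamRun s Q σ τ) : StreamRun s (.ite e P Q) σ τ
  | whileTrue {σ τ ρ : StreamState k} {e : StreamExpr k} {P : StreamProg k}
      (he : e.eval σ.regs ≠ 0) (hP : StreamRun s P σ τ)
      (hW : StreamRun s (.while e P) τ ρ) : StreamRun s (.while e P) σ ρ
  | whileFalse {σ : StreamState k} {e : StreamExpr k} {P : StreamProg k} (h : σ.space ≤ s)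
      (he : e.eval σ.regs = 0) : StreamRun s (.while e P) σ σ

/-- The initial configuration on the given parameters, stream and coins: the parameters are in the
first registers, all other registers are `0`. -/
def StreamState.init (k : ℕ) (params stream : List ℕ) (coins : List Bool) : StreamState k where
  regs i := params.getD i 0
  stream := stream
  coins := coins

/-- The run on the given data halts within space `s` and accepts: it leaves `1` in register `0`. -/
def StreamProg.Accepts {k : ℕ} (P : StreamProg (k + 1)) (s : ℕ) (params stream : List ℕ)
    (coins : List Bool) : Prop :=
  ∃ τ, StreamRun s P (StreamState.init (k + 1) params stream coins) τ ∧ τ.regs 0 = 1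

/-- The probability of acceptance over `ℓ` independent fair coins. -/
noncomputable def StreamProg.acceptProb {k : ℕ} (P : StreamProg (k + 1)) (s : ℕ)
    (params stream : List ℕ) (ℓ : ℕ) : ℝ :=
  ({ω : Fin ℓ → Bool | P.Accepts s params stream (List.ofFn ω)}.ncard : ℝ) / 2 ^ ℓ

/-! ## Codes and tolerant testers -/

open Classical in
/-- The Hamming distance `Δ(y, C)` of a word to a (nonempty) code. -/
noncomputable def distToCode {F : Type*} {n : ℕ} (y : Fin n → F) (C : Set (Fin n → F)) : ℕ :=
  sInf ((fun x => hammingDist y x) '' C)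

/-- The stream that offers `r` passes over the word `y`, whose letters are written as natural
numbers by `enc`. -/
def passes {F : Type*} {n : ℕ} (enc : F → ℕ) (r : ℕ) (y : Fin n → F) : List ℕ :=
  (List.replicate r (List.ofFn fun j => enc (y j))).flatten

/-- `P`, run on the parameters `params`, is an `(r, s, ε₁, ε₂)_{c,d}`-tolerant tester for `C`:
on every word and for all outcomes of the coins it halts after at most `r` passes, using at most
`s` bits of space, and it accepts words at distance at most `ε₁ n` from `C` with probability at
least `c`, words at distance at least `ε₂ n` with probability at most `d`.
Here `ℓ` bounds the number of coin tosses. -/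
def IsTolerantTester {F : Type*} {n k : ℕ} (P : StreamProg (k + 1)) (params : List ℕ)
    (enc : F → ℕ) (C : Set (Fin n → F)) (r s : ℕ) (ε₁ ε₂ c d : ℝ) : Prop :=
  ∃ ℓ : ℕ, ∀ y : Fin n → F,
    (∀ ω : Fin ℓ → Bool, ∃ τ,
      StreamRun s P (StreamState.init (k + 1) params (passes enc r y) (List.ofFn ω)) τ) ∧
    ((distToCode y C : ℝ) ≤ ε₁ * n → c ≤ P.acceptProb s params (passes enc r y) ℓ) ∧
    (ε₂ * n ≤ (distToCode y C : ℝ) → P.acceptProb s params (passes enc r y) ℓ ≤ d)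

/-- An `(r, s)_{c,d}`-error detector: an `(r, s, 0, 1/n)_{c,d}`-tolerant tester. -/
def IsErrorDetector {F : Type*} {n k : ℕ} (P : StreamProg (k + 1)) (params : List ℕ)
    (enc : F → ℕ) (C : Set (Fin n → F)) (r s : ℕ) (c d : ℝ) : Prop :=
  IsTolerantTester P params enc C r s 0 (1 / n) c d

open Classical in
/-- The linear code `C` has rate at least `R` and relative distance at least `δ`. -/
def HasRateDist {F : Type*} [CommRing F] {n : ℕ} (R δ : ℝ) (C : Submodule F (Fin n → F)) : Prop :=
  R * n ≤ (Module.finrank F C : ℝ) ∧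
    ∀ x ∈ C, ∀ y ∈ C, x ≠ y → δ * n ≤ (hammingDist x y : ℝ)

/-! ## Writing finite field elements as natural numbers -/

/-- The polynomial `∑ aᵢ Xⁱ` over `ℤ/p`, `0 ≤ aᵢ < p`, as the natural number `∑ aᵢ pⁱ`. -/
noncomputable def polyCode {p : ℕ} (g : Polynomial (ZMod p)) : ℕ :=
  ∑ i ∈ Finset.range (g.natDegree + 1), (g.coeff i).val * p ^ i

/-- An element of `𝔽_p[X]/(f)` as a number below `p ^ deg f`: the code of its representative of
degree less than `deg f`. -/
noncomputable def fieldCode {p : ℕ} {f : Polynomial (ZMod p)} (hf : f.Monic)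
    (x : AdjoinRoot f) : ℕ :=
  polyCode (AdjoinRoot.modByMonicHom hf x)

/-! ## Verifying stream programs -/

namespace StreamState

variable {k : ℕ}

/-! Both codes are cut out by power-sum checks: the syndromes `S_i = ∑ⱼ yⱼ αⱼ^i`, `i < m`, must
vanish, where `αⱼ` is the field element with number `j`. Storing `m` syndromes is too expensive, so
the detector tosses a point `r` and accumulates `∑ᵢ rⁱ S_i = ∑ⱼ yⱼ ∑ᵢ (r αⱼ)^i` block by block. This
is a polynomial in `r` whose coefficients are the syndromes: it is identically zero on codewords,
and otherwise it has at most `m` roots (`ncard_random_check_le`). Since `r` ranges over `2^⌊log₂ q⌋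
> q/2` elements and `m ≤ q/4`, a word that violates some check passes with probability at most
`1/2`.

For `n ≤ q` this is a Reed-Solomon code with `m = ⌊n/4⌋`; a Vandermonde argument
(`lt_card_of_sum_mul_pow_eq_zero`) gives its distance.

For `q = 2` and `n ≥ 2^40` it is a Justesen code over `𝔽_{2^d}`, `d = ⌊log₂ n⌋`: blocks `(yⱼ, yⱼ
αⱼ)` of `2d` bits whose first halves satisfy the checks. A nonzero codeword has more than `m`
nonzero blocks, and these are pairwise distinct because `αⱼ` is the quotient of the halves. Few
binary words have small weight, so distinct blocks have a large total weight (`le_sum_hammingNorm`,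
`le_hammingNorm_of_mem_blockCode`). The detector checks the relation inside each block
deterministically. For smaller `n` the code is the whole space.

The programs are verified by a weakest precondition calculus that bounds all registers by `2 ^ B`
with `B = O(log n)`. Field arithmetic works on base `p` digits (`fma_spec`); in the binary case the
program finds its own irreducible polynomial, testing candidates by an exhaustive search for zero
divisors (`searchField_spec`). `isErrorDetector_of_forall_run` turns the specifications into
probabilities. -/

@[simp] theorem set_regs (σ : StreamState k) (i j : Fin k) (a : ℕ) :
    (σ.set i a).regs j = if j = i then a else σ.regs j := by
  simp [StreamState.set, Function.update_apply]

@[simp] theorem set_stream (σ : StreamState k) (i : Fin k) (a : ℕ) :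
    (σ.set i a).stream = σ.stream := rfl

@[simp] theorem set_coins (σ : StreamState k) (i : Fin k) (a : ℕ) :
    (σ.set i a).coins = σ.coins := rfl

/-- Every register of `σ` holds a number of at most `B` bits. -/
def Fits (B : ℕ) (σ : StreamState k) : Prop := ∀ i, σ.regs i < 2 ^ B

theorem Fits.space_le {B : ℕ} {σ : StreamState k} (h : σ.Fits B) : σ.space ≤ k * B := by
  unfold StreamState.space
  calc ∑ i, (σ.regs i).size ≤ ∑ _i : Fin k, B :=
        Finset.sum_le_sum fun i _ => Nat.size_le.2 (h i)
    _ = k * B := by simp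

theorem Fits.set {B : ℕ} {σ : StreamState k} (h : σ.Fits B) {i : Fin k} {a : ℕ}
    (ha : a < 2 ^ B) : (σ.set i a).Fits B := by
  intro j
  rw [set_regs]
  split
  · exact ha
  · exact h j

end StreamState

open StreamState

/-- At each configuration at most one rule applies. Exhibiting a single run, as the calculus below
does, therefore settles acceptance in both directions. -/
theorem StreamRun.unique {k s : ℕ} {P : StreamProg k} {σ τ τ' : StreamState k}
    (h : StreamRun s P σ τ) (h' : StreamRun s P σ τ') : τ = τ' := by
  induction h generalizing τ' with
  | skip _ => cases h'; rfl
  | assign _ _ => cases h'; rfl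
  | readLetter _ hl _ =>
    cases h' with
    | readLetter _ hl' _ =>
      rw [hl] at hl'
      obtain ⟨rfl, rfl⟩ := List.cons.inj hl'
      rfl
    | readEnd _ hl' _ => simp [hl] at hl'
  | readEnd _ hl _ =>
    cases h' with
    | readLetter _ hl' _ => simp [hl] at hl'
    | readEnd _ hl' _ => rfl
  | toss _ hl _ =>
    cases h' with
    | toss _ hl' _ =>
      rw [hl] at hl'
      obtain ⟨rfl, rfl⟩ := List.cons.inj hl'
      rfl
  | seq _ _ ihP ihQ =>
    cases h' with
    | seq hP hQ =>
      obtain rfl := ihP hP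
      exact ihQ hQ
  | iteTrue he _ ih =>
    cases h' with
    | iteTrue _ hP => exact ih hP
    | iteFalse he' _ => exact absurd he' he
  | iteFalse he _ ih =>
    cases h' with
    | iteTrue he' _ => exact absurd he he'
    | iteFalse _ hP => exact ih hP
  | whileTrue he _ _ ihP ihW =>
    cases h' with
    | whileTrue _ hP hW =>
      obtain rfl := ihP hP
      exact ihW hW
    | whileFalse _ he' => exact absurd he' he
  | whileFalse _ he =>
    cases h' with
    | whileTrue he' _ _ => exact absurd he he'
    | whileFalse _ _ => rfl

/-! ### Frame conditions and weakest preconditions -/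

namespace StreamProg

variable {k : ℕ}

/-- Register `r` is the target of some instruction of the program. -/
def writesTo (r : Fin k) : StreamProg k → Bool
  | .skip => false
  | .assign i _ => r == i
  | .read i => r == i
  | .toss i => r == i
  | .seq P Q => P.writesTo r || Q.writesTo r
  | .ite _ P Q => P.writesTo r || Q.writesTo r
  | .while _ P => P.writesTo r

/-- The program contains a reading instruction. -/
def reads : StreamProg k → Bool
  | .skip => false
  | .assign _ _ => false
  | .read _ => true
  | .toss _ => false
  | .seq P Q => P.reads || Q.reads
  | .ite _ P Q => P.reads || Q.reads
  | .while _ P => P.reads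

/-- The program contains a coin toss. -/
def tosses : StreamProg k → Bool
  | .skip => false
  | .assign _ _ => false
  | .read _ => false
  | .toss _ => true
  | .seq P Q => P.tosses || Q.tosses
  | .ite _ P Q => P.tosses || Q.tosses
  | .while _ P => P.tosses

/-- What a run of `P` from `σ` to `τ` cannot have changed. -/
structure Frame (P : StreamProg k) (σ τ : StreamState k) : Prop where
  regs : ∀ r, P.writesTo r = false → τ.regs r = σ.regs r
  stream : P.reads = false → τ.stream = σ.stream
  coins : P.tosses = false → τ.coins = σ.coins

theorem Frame.refl (P : StreamProg k) (σ : StreamState k) : P.Frame σ σ :=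
  ⟨fun _ _ => rfl, fun _ => rfl, fun _ => rfl⟩

theorem Frame.trans {P : StreamProg k} {σ τ ρ : StreamState k} (h : P.Frame σ τ)
    (h' : P.Frame τ ρ) : P.Frame σ ρ :=
  ⟨fun r hr => (h'.regs r hr).trans (h.regs r hr), fun hr => (h'.stream hr).trans (h.stream hr),
    fun hr => (h'.coins hr).trans (h.coins hr)⟩

/-- The three tests are syntactic and computable, so for a concrete program and register their
premises are closed by `rfl`. Later proofs carry unchanged registers across subroutines in this way.
-/
theorem _root_.StreamRun.frame {s : ℕ} {P : StreamProg k} {σ τ : StreamState k}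
    (h : StreamRun s P σ τ) : P.Frame σ τ := by
  induction h with
  | skip _ => exact Frame.refl _ _
  | assign _ _ =>
    refine ⟨fun r hr => ?_, fun _ => rfl, fun _ => rfl⟩
    simp_all [writesTo]
  | readLetter _ _ _ =>
    refine ⟨fun r hr => ?_, fun h => by simp [reads] at h, fun _ => rfl⟩
    simp_all [writesTo, StreamState.set]
  | readEnd _ _ _ =>
    refine ⟨fun r hr => ?_, fun h => by simp [reads] at h, fun _ => rfl⟩
    simp_all [writesTo]
  | toss _ _ _ =>
    refine ⟨fun r hr => ?_, fun _ => rfl, fun h => by simp [tosses] at h⟩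
    simp_all [writesTo, StreamState.set]
  | seq _ _ ihP ihQ =>
    constructor
    · intro r hr
      simp only [writesTo, Bool.or_eq_false_iff] at hr
      rw [ihQ.regs r hr.2, ihP.regs r hr.1]
    · intro hr
      simp only [reads, Bool.or_eq_false_iff] at hr
      rw [ihQ.stream hr.2, ihP.stream hr.1]
    · intro hr
      simp only [tosses, Bool.or_eq_false_iff] at hr
      rw [ihQ.coins hr.2, ihP.coins hr.1]
  | iteTrue _ _ ih =>
    constructor
    · intro r hr
      simp only [writesTo, Bool.or_eq_false_iff] at hr
      exact ih.regs r hr.1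
    · intro hr
      simp only [reads, Bool.or_eq_false_iff] at hr
      exact ih.stream hr.1
    · intro hr
      simp only [tosses, Bool.or_eq_false_iff] at hr
      exact ih.coins hr.1
  | iteFalse _ _ ih =>
    constructor
    · intro r hr
      simp only [writesTo, Bool.or_eq_false_iff] at hr
      exact ih.regs r hr.2
    · intro hr
      simp only [reads, Bool.or_eq_false_iff] at hr
      exact ih.stream hr.2
    · intro hr
      simp only [tosses, Bool.or_eq_false_iff] at hr
      exact ih.coins hr.2
  | whileTrue _ _ _ ihP ihW =>
    exact Frame.trans ⟨fun r hr => ihP.regs r hr, fun hr => ihP.stream hr,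
      fun hr => ihP.coins hr⟩ ihW
  | whileFalse _ _ => exact Frame.refl _ _

/-- The weakest precondition for total correctness: if all registers of `σ` have at most `B` bits,
then `P` halts from `σ` in a state that satisfies `Q`, and all registers have at most `B` bits
throughout. -/
def WP (B : ℕ) (P : StreamProg k) (Q : StreamState k → Prop) (σ : StreamState k) : Prop :=
  σ.Fits B → ∃ τ, StreamRun (k * B) P σ τ ∧ τ.Fits B ∧ Q τ

variable {B : ℕ} {P P' : StreamProg k} {Q Q' : StreamState k → Prop} {σ : StreamState k}

theorem WP.of_fits (h : σ.Fits B → P.WP B Q σ) : P.WP B Q σ := fun hσ => h hσ hσ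

/-- The consequence rule through which subroutines are used: a specification states only what is
computed, and the frame supplies everything left untouched. -/
theorem WP.mono_frame (h : P.WP B Q' σ) (hQ : ∀ τ, P.Frame σ τ → τ.Fits B → Q' τ → Q τ) :
    P.WP B Q σ := fun hσ =>
  let ⟨τ, hr, hf, hq⟩ := h hσ
  ⟨τ, hr, hf, hQ τ hr.frame hf hq⟩

theorem WP.assign {i : Fin k} {e : StreamExpr k} (he : e.eval σ.regs < 2 ^ B)
    (h : Q (σ.set i (e.eval σ.regs))) : WP B (.assign i e) Q σ := fun hσ =>
  ⟨_, .assign hσ.space_le (hσ.set he).space_le, hσ.set he, h⟩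

theorem WP.seq (h : P.WP B (P'.WP B Q) σ) : WP B (.seq P P') Q σ := fun hσ =>
  let ⟨_, hr, hf, hq⟩ := h hσ
  let ⟨ρ, hr', hf', hq'⟩ := hq hf
  ⟨ρ, .seq hr hr', hf', hq'⟩

theorem WP.ite {e : StreamExpr k} (h : e.eval σ.regs ≠ 0 → P.WP B Q σ)
    (h' : e.eval σ.regs = 0 → P'.WP B Q σ) : WP B (.ite e P P') Q σ := by
  intro hσ
  by_cases he : e.eval σ.regs = 0
  · obtain ⟨τ, hr, hf, hq⟩ := h' he hσ
    exact ⟨τ, .iteFalse he hr, hf, hq⟩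
  · obtain ⟨τ, hr, hf, hq⟩ := h he hσ
    exact ⟨τ, .iteTrue he hr, hf, hq⟩

/-- Writing the remaining stream as `L.drop t` unites the two reading rules, since `getD` yields `0`
past the end and `drop` stays empty. This zero padding matches the shortening of block codes to
arbitrary length. -/
theorem WP.read {i : Fin k} {L : List ℕ} {t : ℕ} (hl : σ.stream = L.drop t)
    (hL : L.getD t 0 < 2 ^ B)
    (h : Q { σ.set i (L.getD t 0) with stream := L.drop (t + 1) }) : WP B (.read i) Q σ := by
  intro hσ
  by_cases ht : t < L.length
  · have e : L.getD t 0 = L[t] := by simp [ht]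
    rw [e] at h hL
    exact ⟨_, .readLetter hσ.space_le (hl.trans (List.drop_eq_getElem_cons ht))
      (hσ.set hL).space_le, hσ.set hL, h⟩
  · have e : L.getD t 0 = 0 := by simp [not_lt.1 ht]
    have hs : L.drop t = [] := by simp [not_lt.1 ht]
    have hs' : L.drop (t + 1) = [] := by simp; omega
    rw [e, hs'] at h
    rw [e] at hL
    refine ⟨_, .readEnd hσ.space_le (hl.trans hs) (hσ.set hL).space_le, hσ.set hL, ?_⟩
    convert h using 1
    rw [hs] at hl
    rw [← hl]
    rfl

theorem WP.toss {i : Fin k} {b : Bool} {l : List Bool} (hl : σ.coins = b :: l) (hB : 0 < B)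
    (h : Q { σ.set i b.toNat with coins := l }) : WP B (.toss i) Q σ := by
  intro hσ
  have hb : b.toNat < 2 ^ B :=
    lt_of_lt_of_le (Bool.toNat_lt b) (by simpa using Nat.pow_le_pow_right (n := 2) (by simp) hB)
  exact ⟨_, .toss hσ.space_le hl (hσ.set hb).space_le, hσ.set hb, h⟩

/-- A loop with invariant `Inv` that is run exactly `T` times. -/
theorem WP.while {e : StreamExpr k} (T : ℕ) (Inv : ℕ → StreamState k → Prop) (h0 : Inv 0 σ)
    (hstep : ∀ i < T, ∀ τ, P.Frame σ τ → τ.Fits B → Inv i τ →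
      e.eval τ.regs ≠ 0 ∧ P.WP B (Inv (i + 1)) τ)
    (hend : ∀ τ, P.Frame σ τ → τ.Fits B → Inv T τ → e.eval τ.regs = 0 ∧ Q τ) :
    WP B (.while e P) Q σ := by
  intro hσ
  have key : ∀ j i, i + j = T → ∀ τ, P.Frame σ τ → τ.Fits B → Inv i τ →
      ∃ ρ, StreamRun (k * B) (.while e P) τ ρ ∧ ρ.Fits B ∧ Q ρ := by
    intro j
    induction j with
    | zero =>
      rintro i rfl τ hfr hf hi
      obtain ⟨he, hq⟩ := hend τ hfr hf hi
      exact ⟨τ, .whileFalse hf.space_le he, hf, hq⟩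
    | succ j ih =>
      intro i hij τ hfr hf hi
      obtain ⟨he, hw⟩ := hstep i (by omega) τ hfr hf hi
      obtain ⟨τ', hr, hf', hi'⟩ := hw hf
      obtain ⟨ρ, hr', hρ⟩ := ih (i + 1) (by omega) τ' (hfr.trans hr.frame) hf' hi'
      exact ⟨ρ, .whileTrue he hr hr', hρ⟩
  exact key T 0 (by simp) σ (Frame.refl _ _) hσ h0

end StreamProg

open StreamProg

/-! ## Ring elements given by the digits of natural numbers -/

section DigitSum

variable {A : Type*} [CommRing A]

/-- The value at `x` of the polynomial whose coefficients are the `p`-ary digits number `0` to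
`i - 1` of `a`, in a ring with `p = 0` (so that the digits need not be reduced modulo `p`). -/
def digitSum (x : A) (p i a : ℕ) : A := ∑ t ∈ Finset.range i, ((a / p ^ t : ℕ) : A) * x ^ t

variable {x : A} {p : ℕ}

theorem digitSum_zero_left (a : ℕ) : digitSum x p 0 a = 0 := by simp [digitSum]

theorem digitSum_zero (i : ℕ) : digitSum x p i 0 = 0 := by simp [digitSum]

theorem digitSum_succ (i a : ℕ) :
    digitSum x p (i + 1) a = digitSum x p i a + ((a / p ^ i : ℕ) : A) * x ^ i :=
  Finset.sum_range_succ _ _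

theorem digitSum_one (hp : 2 ≤ p) {i : ℕ} (hi : 1 ≤ i) : digitSum x p i 1 = 1 := by
  obtain ⟨i, rfl⟩ := Nat.exists_eq_add_of_le' hi
  unfold digitSum
  rw [Finset.sum_range_succ', Finset.sum_eq_zero]
  · simp
  · intro t _
    rw [Nat.div_eq_of_lt (Nat.one_lt_pow (by omega) (by omega))]
    simp

/-- The term `c * p ^ i` changes each lower quotient only by a multiple of `p`, which vanishes in
`A`. -/
theorem digitSum_succ_add_mul_pow (hp : 0 < p) (hA : (p : A) = 0) {i r : ℕ} (hr : r < p ^ i)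
    (c : ℕ) : digitSum x p (i + 1) (r + c * p ^ i) = digitSum x p i r + c * x ^ i := by
  rw [digitSum_succ, Nat.add_mul_div_right _ _ (by positivity), Nat.div_eq_of_lt hr, zero_add]
  congr 1
  refine Finset.sum_congr rfl fun t ht => ?_
  obtain ⟨s, rfl⟩ := Nat.exists_eq_add_of_lt (Finset.mem_range.1 ht)
  have : c * p ^ (t + s + 1) = (c * p ^ s * p) * p ^ t := by ring
  rw [this, Nat.add_mul_div_right _ _ (by positivity)]
  simp [hA]

/-- Multiplication by `p` shifts the digits up by one place; the new lowest quotient `a * p` is zero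
in `A`. -/
theorem digitSum_succ_mul (hp : 0 < p) (hA : (p : A) = 0) (d a : ℕ) :
    digitSum x p (d + 1) (a * p) = x * digitSum x p d a := by
  unfold digitSum
  rw [Finset.sum_range_succ', Finset.mul_sum]
  simp only [pow_zero, Nat.div_one, Nat.cast_mul, hA, mul_zero, zero_mul, add_zero]
  refine Finset.sum_congr rfl fun t _ => ?_
  rw [pow_succ p, Nat.mul_div_mul_right _ _ hp]
  ring

theorem natCast_mod_eq (hA : (p : A) = 0) (a : ℕ) : ((a % p : ℕ) : A) = a := by
  conv_rhs => rw [← Nat.mod_add_div a p]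
  simp [hA]

/-- Multiplication by `x`, in a ring in which `x ^ d` is given by the digits of `-F`. -/
theorem mul_digitSum_eq (hp : 0 < p) (hA : (p : A) = 0) {d F : ℕ}
    (hF : x ^ d + digitSum x p d F = 0) (a : ℕ) :
    digitSum x p d (a * p) + (((p - 1) * (a * p / p ^ d) : ℕ) : A) * digitSum x p d F
      = x * digitSum x p d a := by
  have h := digitSum_succ_mul (x := x) hp hA d a
  rw [digitSum_succ] at h
  -- In `A` the factor `p - 1` is `-1`; the overflowing digit multiplies `x ^ d`, which `hF` trades
  -- for minus the digits of `F`.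
  rw [← h, Nat.cast_mul, Nat.cast_sub hp, hA]
  push_cast
  linear_combination (-((a * p / p ^ d : ℕ) : A)) * hF

theorem add_mul_pow_lt {p i r c : ℕ} (hr : r < p ^ i) (hc : c < p) :
    r + c * p ^ i < p ^ (i + 1) := by
  calc r + c * p ^ i < (c + 1) * p ^ i := by linarith
    _ ≤ p * p ^ i := Nat.mul_le_mul_right _ hc
    _ = p ^ (i + 1) := by ring

end DigitSum

/-! ## Syntax for programs -/

section Notations

variable {k : ℕ}

instance : Add (StreamExpr k) := ⟨.add⟩
instance : Sub (StreamExpr k) := ⟨.sub⟩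
instance : Mul (StreamExpr k) := ⟨.mul⟩
instance : Div (StreamExpr k) := ⟨.div⟩
instance : Mod (StreamExpr k) := ⟨.mod⟩
instance (a : ℕ) : OfNat (StreamExpr k) a := ⟨.const a⟩

namespace StreamExpr

variable (v : Fin k → ℕ) (e₁ e₂ : StreamExpr k)

@[simp] theorem eval_reg (i : Fin k) : (reg i).eval v = v i := rfl
@[simp] theorem eval_const (a : ℕ) : (const a : StreamExpr k).eval v = a := rfl
@[simp] theorem eval_zero : (0 : StreamExpr k).eval v = 0 := rfl
@[simp] theorem eval_one : (1 : StreamExpr k).eval v = 1 := rfl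
@[simp] theorem eval_two : (2 : StreamExpr k).eval v = 2 := rfl
@[simp] theorem eval_four : (4 : StreamExpr k).eval v = 4 := rfl
@[simp] theorem eval_add : (e₁ + e₂).eval v = e₁.eval v + e₂.eval v := rfl
@[simp] theorem eval_sub : (e₁ - e₂).eval v = e₁.eval v - e₂.eval v := rfl
@[simp] theorem eval_mul : (e₁ * e₂).eval v = e₁.eval v * e₂.eval v := rfl
@[simp] theorem eval_div : (e₁ / e₂).eval v = e₁.eval v / e₂.eval v := rfl
@[simp] theorem eval_mod : (e₁ % e₂).eval v = e₁.eval v % e₂.eval v := rfl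

end StreamExpr

/-- The content of a register, as an expression. -/
abbrev V (i : Fin 24) : StreamExpr 24 := .reg i

end Notations

infixr:60 " ;; " => StreamProg.seq
infix:62 " ::= " => StreamProg.assign

/-! The registers of the programs below: the parameters `n`, `p`, `f`; the size `q` of the field;
the number of blocks and the number of parity checks; the random point `r`; the sum; the loop
counters and temporary values. -/

notation "rN" => (0 : Fin 24)
notation "rP" => (1 : Fin 24)
notation "rF" => (2 : Fin 24)
notation "rQ" => (3 : Fin 24)
notation "rBlocks" => (4 : Fin 24)
notation "rChecks" => (5 : Fin 24)
notation "rPoint" => (6 : Fin 24)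
notation "rSum" => (7 : Fin 24)
notation "rJ" => (8 : Fin 24)
notation "rU" => (9 : Fin 24)
notation "rI" => (10 : Fin 24)
notation "rY" => (11 : Fin 24)
notation "rOk" => (12 : Fin 24)
notation "rC" => (13 : Fin 24)
notation "rA" => (14 : Fin 24)
notation "rB" => (15 : Fin 24)
notation "rV" => (16 : Fin 24)
notation "rW" => (17 : Fin 24)
notation "rX₁" => (18 : Fin 24)
notation "rX₂" => (19 : Fin 24)
notation "rZ" => (20 : Fin 24)
notation "rD" => (21 : Fin 24)
notation "rT" => (22 : Fin 24)
notation "rE" => (23 : Fin 24)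

/-! ## Arithmetic in `𝔽_p[X]/(f)` -/

/-- Digit by digit, `X₁ := C + b A` and `X₂ := X A`, where `b` is the digit of `B` at `V`. -/
def fmaDigits : StreamProg 24 :=
  .while (V rQ - V rW) (
    rX₁ ::= V rX₁ + ((V rC / V rW + (V rB / V rV) * (V rA / V rW)) % V rP) * V rW ;;
    rX₂ ::= V rX₂ + ((V rA * V rP / V rW
      + (V rP - 1) * (V rA * V rP / V rQ) * (V rF / V rW)) % V rP) * V rW ;;
    rW ::= V rW * V rP)

/-- `C := C + A B`. -/
def fma : StreamProg 24 :=
  rV ::= 1 ;;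
  .while (V rQ - V rV) (
    rX₁ ::= 0 ;; rX₂ ::= 0 ;; rW ::= 1 ;;
    fmaDigits ;;
    rC ::= V rX₁ ;; rA ::= V rX₂ ;; rV ::= V rV * V rP)

/-- The registers `p`, `q` and `f` describe the ring `A`, in which `x` satisfies the equation
`f = 0` of degree `d`. -/
structure RingRegs {A : Type*} [CommRing A] (x : A) (p d : ℕ) (σ : StreamState 24) : Prop where
  two_le : 2 ≤ p
  one_le : 1 ≤ d
  cast_eq : (p : A) = 0
  regP : σ.regs rP = p
  regQ : σ.regs rQ = p ^ d
  root : x ^ d + digitSum x p d (σ.regs rF) = 0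

section Fma

variable {A : Type*} [CommRing A] {x : A} {p d B : ℕ} {σ τ : StreamState 24}

theorem RingRegs.congr (h : RingRegs x p d σ) (hP : τ.regs rP = σ.regs rP)
    (hQ : τ.regs rQ = σ.regs rQ) (hF : τ.regs rF = σ.regs rF) : RingRegs x p d τ :=
  ⟨h.two_le, h.one_le, h.cast_eq, hP ▸ h.regP, hQ ▸ h.regQ, hF ▸ h.root⟩

theorem RingRegs.pos (h : RingRegs x p d σ) : 0 < p := by have := h.two_le; omega

theorem RingRegs.one_lt (h : RingRegs x p d σ) : 1 < p ^ d :=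
  Nat.one_lt_pow (by have := h.one_le; omega) h.two_le

theorem RingRegs.lt (h : RingRegs x p d σ) (hσ : σ.Fits B) : p ^ d < 2 ^ B :=
  h.regQ ▸ hσ rQ

/-- Each new digit is reduced modulo `p`, which keeps the results below `p ^ d`; the digit of `B`
enters unreduced as `B / V`, harmless since `p = 0` in `A`. Only a commutative ring is assumed,
because the search for a field runs the same code modulo reducible polynomials. -/
theorem fmaDigits_spec (h : RingRegs x p d σ) (h₁ : σ.regs rX₁ = 0) (h₂ : σ.regs rX₂ = 0)
    (hW : σ.regs rW = 1) :
    fmaDigits.WP B (fun τ => τ.regs rX₁ < p ^ d ∧ τ.regs rX₂ < p ^ d ∧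
      digitSum x p d (τ.regs rX₁) = digitSum x p d (σ.regs rC)
        + ((σ.regs rB / σ.regs rV : ℕ) : A) * digitSum x p d (σ.regs rA) ∧
      digitSum x p d (τ.regs rX₂) = x * digitSum x p d (σ.regs rA)) σ := by
  refine WP.of_fits fun hσ => ?_
  have hq := h.lt hσ
  refine WP.while d (fun i τ => τ.regs rW = p ^ i ∧ τ.regs rX₁ < p ^ i ∧ τ.regs rX₂ < p ^ i ∧
      digitSum x p i (τ.regs rX₁) = digitSum x p i (σ.regs rC)
        + ((σ.regs rB / σ.regs rV : ℕ) : A) * digitSum x p i (σ.regs rA) ∧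
      digitSum x p i (τ.regs rX₂) = digitSum x p i (σ.regs rA * p)
        + (((p - 1) * (σ.regs rA * p / p ^ d) : ℕ) : A) * digitSum x p i (σ.regs rF)) ?_ ?_ ?_
  · simp [h₁, h₂, hW, digitSum_zero_left]
  · rintro i hi τ hfr hτ ⟨tW, t₁, t₂, e₁, e₂⟩
    have fP := (hfr.regs rP rfl).trans h.regP
    have fQ := (hfr.regs rQ rfl).trans h.regQ
    have fF := hfr.regs rF rfl
    have fC := hfr.regs rC rfl
    have fA := hfr.regs rA rfl
    have fB := hfr.regs rB rfl
    have fV := hfr.regs rV rfl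
    have hid : p ^ i < p ^ d := Nat.pow_lt_pow_right h.two_le hi
    have hid' : p ^ (i + 1) ≤ p ^ d := Nat.pow_le_pow_right h.pos hi
    have b₁ := add_mul_pow_lt t₁ (Nat.mod_lt (σ.regs rC / p ^ i
      + (σ.regs rB / σ.regs rV) * (σ.regs rA / p ^ i)) h.pos)
    have b₂ := add_mul_pow_lt t₂ (Nat.mod_lt (σ.regs rA * p / p ^ i
      + (p - 1) * (σ.regs rA * p / p ^ d) * (σ.regs rF / p ^ i)) h.pos)
    refine ⟨by simp [fQ, tW]; omega, ?_⟩
    refine WP.seq <| WP.assign ?_ <| WP.seq <| WP.assign ?_ <| WP.assign ?_ ?_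
    · simp [fP, fC, fB, fV, fA, tW]
      omega
    · simp [fP, fQ, fA, fF, tW]
      omega
    · simp [fP, tW, ← pow_succ]
      omega
    · simp [fP, fQ, fA, fF, fC, fB, fV, tW]
      refine ⟨by ring, b₁, b₂, ?_, ?_⟩
      · rw [digitSum_succ_add_mul_pow h.pos h.cast_eq t₁, natCast_mod_eq h.cast_eq, e₁,
          digitSum_succ, digitSum_succ]
        push_cast
        ring
      · rw [digitSum_succ_add_mul_pow h.pos h.cast_eq t₂, natCast_mod_eq h.cast_eq, e₂,
          digitSum_succ, digitSum_succ]
        push_cast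
        ring
  · rintro τ hfr hτ ⟨tW, t₁, t₂, e₁, e₂⟩
    have fQ := (hfr.regs rQ rfl).trans h.regQ
    refine ⟨by simp [fQ, tW], t₁, t₂, e₁, ?_⟩
    -- Only once all `d` digits are present does subtracting the overflow times the lower part of
    -- `f` amount to multiplication by `x`.
    rw [e₂, mul_digitSum_eq h.pos h.cast_eq h.root]

/-- Schoolbook multiplication: before round `i` the register `A` holds `x ^ i` times its initial
value, and the round adds digit `i` of `B` times this to `C`. Register `B` is never written, so
callers can reuse it. -/
theorem fma_spec (h : RingRegs x p d σ) (hC : σ.regs rC < p ^ d) (hA : σ.regs rA < p ^ d) :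
    fma.WP B (fun τ => τ.regs rC < p ^ d ∧ digitSum x p d (τ.regs rC) =
      digitSum x p d (σ.regs rC) + digitSum x p d (σ.regs rA) * digitSum x p d (σ.regs rB)) σ := by
  refine WP.of_fits fun hσ => ?_
  have hq := h.lt hσ
  have h1 := h.one_lt
  refine WP.seq <| WP.assign (h1.trans hq) ?_
  refine WP.while d (fun i τ => τ.regs rV = p ^ i ∧ τ.regs rC < p ^ d ∧ τ.regs rA < p ^ d ∧
      digitSum x p d (τ.regs rC) = digitSum x p d (σ.regs rC)
        + digitSum x p d (σ.regs rA) * digitSum x p i (σ.regs rB) ∧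
      digitSum x p d (τ.regs rA) = x ^ i * digitSum x p d (σ.regs rA)) ?_ ?_ ?_
  · simp [hC, hA, digitSum_zero_left]
  · rintro i hi τ hfr hτ ⟨tV, tC, tA, eC, eA⟩
    have fP := (hfr.regs rP rfl)
    have fQ := (hfr.regs rQ rfl)
    have fF := hfr.regs rF rfl
    have fB := hfr.regs rB rfl
    simp at fP fQ fF fB
    have hid : p ^ i < p ^ d := Nat.pow_lt_pow_right h.two_le hi
    have hid' : p ^ (i + 1) ≤ p ^ d := Nat.pow_le_pow_right h.pos hi
    have hτr : RingRegs x p d τ := h.congr fP fQ fF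
    refine ⟨by simp [fQ, h.regQ, tV]; omega, ?_⟩
    refine WP.seq <| WP.assign (by simp) <| WP.seq <| WP.assign (by simp) <|
      WP.seq <| WP.assign (h1.trans hq) <| WP.seq ?_
    refine WP.mono_frame (fmaDigits_spec (x := x) (p := p) (d := d)
      (hτr.congr (by simp) (by simp) (by simp)) (by simp) (by simp) (by simp)) ?_
    rintro ρ hfr' hρ ⟨l₁, l₂, e₁, e₂⟩
    have gP := hfr'.regs rP rfl
    have gV := hfr'.regs rV rfl
    simp at gP gV e₁ e₂
    refine WP.seq <| WP.assign ?_ <| WP.seq <| WP.assign ?_ <| WP.assign ?_ ?_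
    · simp; omega
    · simp; omega
    · simp [gP, gV, fP, h.regP, tV, ← pow_succ]; omega
    · simp [gP, gV, fP, h.regP, tV, l₁, l₂, e₁, e₂, eC, eA, fB, ← pow_succ, digitSum_succ]
      constructor <;> ring
  · rintro τ hfr hτ ⟨tV, tC, tA, eC, eA⟩
    have fQ := (hfr.regs rQ rfl)
    simp at fQ
    exact ⟨by simp [fQ, h.regQ, tV], tC, eC⟩

end Fma

/-! ## The parts of the error detectors -/

/-- `S := S + y ∑_{i < m} (r j)^i`, where `m` is the number of parity checks. -/
def accumulate : StreamProg 24 :=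
  rC ::= 0 ;; rA ::= V rPoint ;; rB ::= V rJ ;; fma ;; rB ::= V rC ;;
  rU ::= 0 ;; rI ::= 0 ;;
  .while (V rChecks - V rI) (
    rC ::= 1 ;; rA ::= V rU ;; fma ;; rU ::= V rC ;; rI ::= V rI + 1) ;;
  rC ::= V rSum ;; rA ::= V rY ;; rB ::= V rU ;; fma ;; rSum ::= V rC

/-- Toss the random point, one bit for each factor `2` in `q`. -/
def tossPoint : StreamProg 24 :=
  rPoint ::= 0 ;; rW ::= 1 ;;
  .while (V rQ + 1 - 2 * V rW) (
    .toss rT ;; rPoint ::= V rPoint + V rT * V rW ;; rW ::= 2 * V rW)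

/-- `q` becomes the largest power of `p` that is at most the content of register `t`. -/
def fieldSize (t : Fin 24) : StreamProg 24 :=
  rQ ::= 1 ;; rD ::= 0 ;;
  .while (V t + 1 - V rQ * V rP) (rQ ::= V rQ * V rP ;; rD ::= V rD + 1)

/-- Read the digits of a field element of characteristic `2` into `C`. -/
def readBits : StreamProg 24 :=
  rC ::= 0 ;; rW ::= 1 ;;
  .while (V rQ - V rW) (.read rT ;; rC ::= V rC + V rT * V rW ;; rW ::= V rW * 2)

/-- Test whether the ring has no zero divisors. -/
def domainTest : StreamProg 24 :=
  rE ::= 0 ;; rOk ::= 1 ;;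
  .while (V rQ * V rQ - V rE) (
    rC ::= 0 ;; rA ::= V rE / V rQ ;; rB ::= V rE % V rQ ;; fma ;;
    rOk ::= V rOk * (1 - (V rE / V rQ) * (V rE % V rQ) * (1 - V rC)) ;;
    rE ::= V rE + 1)

/-! ### Correctness of the subroutines -/

section Specs

variable {A : Type*} [CommRing A] {x : A} {p d B : ℕ} {σ τ : StreamState 24}

/-- The geometric sum is evaluated by Horner's rule `u ↦ 1 + u (r αⱼ)`, so no separate power has to
be stored. -/
theorem accumulate_spec (h : RingRegs x p d σ) (hR : σ.regs rPoint < p ^ d)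
    (hS : σ.regs rSum < p ^ d) (hY : σ.regs rY < p ^ d) :
    accumulate.WP B (fun τ => τ.regs rSum < p ^ d ∧ digitSum x p d (τ.regs rSum) =
      digitSum x p d (σ.regs rSum) + digitSum x p d (σ.regs rY) *
        ∑ i ∈ Finset.range (σ.regs rChecks),
          (digitSum x p d (σ.regs rPoint) * digitSum x p d (σ.regs rJ)) ^ i) σ := by
  refine WP.of_fits fun hσ => ?_
  have hq := h.lt hσ
  have h1 := h.one_lt
  have hSB := hσ rSum
  have hRB := hσ rPoint
  have hJB := hσ rJ
  have hYB := hσ rY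
  refine WP.seq <| WP.assign (by simp) <| WP.seq <| WP.assign (by simpa using hRB) <|
    WP.seq <| WP.assign (by simpa using hJB) <| WP.seq ?_
  refine WP.mono_frame (fma_spec (x := x) (p := p) (d := d)
    (h.congr (by simp) (by simp) (by simp)) (by simp; omega) (by simpa using hR)) ?_
  rintro τ hfr hτ ⟨tC, eC⟩
  have fP := hfr.regs rP rfl
  have fQ := hfr.regs rQ rfl
  have fF := hfr.regs rF rfl
  have fK := hfr.regs rChecks rfl
  have fS := hfr.regs rSum rfl
  have fY := hfr.regs rY rfl
  simp [digitSum_zero] at fP fQ fF fK fS fY eC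
  refine WP.seq <| WP.assign (by simp; omega) <| WP.seq <| WP.assign (by simp) <|
    WP.seq <| WP.assign (by simp) <| WP.seq ?_
  refine WP.while (σ.regs rChecks) (fun i τ => τ.regs rI = i ∧ τ.regs rU < p ^ d ∧
    digitSum x p d (τ.regs rU) = ∑ i ∈ Finset.range i,
      (digitSum x p d (σ.regs rPoint) * digitSum x p d (σ.regs rJ)) ^ i) ?_ ?_ ?_
  · simp [digitSum_zero]; omega
  · rintro i hi ρ hfr' hρ ⟨tI, tU, eU⟩
    have gP := hfr'.regs rP rfl
    have gQ := hfr'.regs rQ rfl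
    have gF := hfr'.regs rF rfl
    have gK := hfr'.regs rChecks rfl
    have gB := hfr'.regs rB rfl
    simp [fP, fQ, fF, fK] at gP gQ gF gK gB
    have hK := hσ rChecks
    refine ⟨by simp [tI, gK]; omega, ?_⟩
    refine WP.seq <| WP.assign (h1.trans hq) <| WP.seq <| WP.assign (by simp; omega) <|
      WP.seq ?_
    refine WP.mono_frame (fma_spec (x := x) (p := p) (d := d)
      (h.congr (by simp [gP]) (by simp [gQ]) (by simp [gF])) (by simp; omega)
      (by simpa using tU)) ?_
    rintro π hfr'' hπ ⟨uC, vC⟩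
    have kI := hfr''.regs rI rfl
    simp [digitSum_one h.two_le h.one_le] at kI vC
    refine WP.seq <| WP.assign (by simp; omega) <| WP.assign (by simp; omega) ?_
    simp [kI, tI, uC, vC, eU, gB, eC]
    rw [Finset.sum_range_succ', Finset.sum_mul]
    simp [pow_succ, add_comm]
  · rintro ρ hfr' hρ ⟨tI, tU, eU⟩
    have gP := hfr'.regs rP rfl
    have gQ := hfr'.regs rQ rfl
    have gF := hfr'.regs rF rfl
    have gK := hfr'.regs rChecks rfl
    have gS := hfr'.regs rSum rfl
    have gY := hfr'.regs rY rfl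
    simp [fP, fQ, fF, fK, fS, fY] at gP gQ gF gK gS gY
    refine ⟨by simp [tI, gK], ?_⟩
    refine WP.seq <| WP.assign (by simp; omega) <| WP.seq <| WP.assign (by simp; omega) <|
      WP.seq <| WP.assign (by simp; omega) <| WP.seq ?_
    refine WP.mono_frame (fma_spec (x := x) (p := p) (d := d)
      (h.congr (by simp [gP]) (by simp [gQ]) (by simp [gF])) (by simp; omega)
      (by simp; omega)) ?_
    rintro π hfr'' hπ ⟨uC, vC⟩
    simp [gS, gY, eU] at vC
    refine WP.assign (by simp; omega) ?_
    simp [uC, vC]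

/-- The coins are the binary digits of the point. Stopping at the largest power of two not above `q`
avoids rejection sampling and still covers more than half of the field. -/
theorem tossPoint_spec {q : ℕ} (hq : 1 < q) (hQ : σ.regs rQ = q)
    (hc : σ.coins.length = Nat.log 2 q) :
    tossPoint.WP B (fun τ => τ.regs rPoint = Nat.ofDigits 2 (σ.coins.map Bool.toNat)) σ := by
  refine WP.of_fits fun hσ => ?_
  have hB := hQ ▸ hσ rQ
  refine WP.seq <| WP.assign (by simp) <| WP.seq <|
    WP.assign (hq.trans hB) ?_
  refine WP.while (Nat.log 2 q) (fun i τ => τ.regs rW = 2 ^ i ∧ τ.regs rPoint < 2 ^ i ∧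
    τ.coins.length + i = Nat.log 2 q ∧
    τ.regs rPoint + 2 ^ i * Nat.ofDigits 2 (τ.coins.map Bool.toNat)
      = Nat.ofDigits 2 (σ.coins.map Bool.toNat)) ?_ ?_ ?_
  · simp [hc]
  · rintro i hi τ hfr hτ ⟨tW, tR, tc, e⟩
    have fQ := hfr.regs rQ rfl
    simp [hQ] at fQ
    have hiq : 2 ^ (i + 1) ≤ q := (Nat.le_log_iff_pow_le (by simp) (by omega)).1 hi
    refine ⟨by simp [fQ, tW]; rw [pow_succ] at hiq; omega, ?_⟩
    obtain ⟨b, l, hbl⟩ : ∃ b l, τ.coins = b :: l := by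
      cases hτc : τ.coins with
      | nil => simp [hτc] at tc; omega
      | cons b l => exact ⟨b, l, rfl⟩
    have hb : b.toNat < 2 := Bool.toNat_lt b
    have hlt := add_mul_pow_lt tR hb
    refine WP.seq <| WP.toss hbl (Nat.pos_of_ne_zero ?_) <| WP.seq <| WP.assign ?_ <|
      WP.assign ?_ ?_
    · rintro rfl
      have := hτ rW
      rw [tW] at this
      have := Nat.one_le_two_pow (n := i)
      omega
    · simp [StreamState.set, tW]
      omega
    · simp [StreamState.set, tW]
      rw [pow_succ'] at hiq
      omega
    · simp [StreamState.set, tW]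
      refine ⟨by ring, hlt, ?_, ?_⟩
      · rw [hbl] at tc
        simp at tc
        omega
      · rw [← e, hbl]
        simp [Nat.ofDigits_cons]
        ring
  · rintro τ hfr hτ ⟨tW, tR, tc, e⟩
    have fQ := hfr.regs rQ rfl
    simp [hQ] at fQ
    have := Nat.lt_pow_succ_log_self (b := 2) (by simp) q
    refine ⟨by simp [fQ, tW]; rw [pow_succ] at this; omega, ?_⟩
    have : τ.coins = [] := List.length_eq_zero_iff.1 (by omega)
    simpa [this] using e

/-- Applied to the code of a monic `f` this recovers `p ^ deg f`; applied to `n` it chooses the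
field of the binary construction. -/
theorem fieldSize_spec {t : Fin 24} (htQ : t ≠ rQ) (htD : t ≠ rD) (hp : 2 ≤ p)
    (hP : σ.regs rP = p) (ht : 1 ≤ σ.regs t) :
    (fieldSize t).WP B (fun τ => τ.regs rQ = p ^ Nat.log p (σ.regs t) ∧
      τ.regs rD = Nat.log p (σ.regs t)) σ := by
  refine WP.of_fits fun hσ => ?_
  have hlog : Nat.log p (σ.regs t) ≤ σ.regs t := Nat.log_le_self _ _
  have htB := hσ t
  have hPB := hσ rP
  refine WP.seq <| WP.assign (show 1 < 2 ^ B by omega) <| WP.seq <| WP.assign (by simp) ?_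
  refine WP.while (Nat.log p (σ.regs t)) (fun i τ => τ.regs rQ = p ^ i ∧ τ.regs rD = i) ?_ ?_ ?_
  · simp
  · rintro i hi τ hfr hτ ⟨tQ, tD⟩
    have fP := hfr.regs rP rfl
    have ft := hfr.regs t (by simp [writesTo, htQ, htD])
    simp [hP, htQ, htD] at fP ft
    have hiq : p ^ (i + 1) ≤ σ.regs t := (Nat.le_log_iff_pow_le hp (by omega)).1 hi
    refine ⟨by simp [fP, ft, tQ, ← pow_succ]; omega, ?_⟩
    refine WP.seq <| WP.assign ?_ <| WP.assign ?_ ?_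
    · simp [tQ, fP, ← pow_succ]; omega
    · simp [tD]; omega
    · simp [tQ, tD, fP, ← pow_succ]
  · rintro τ hfr hτ ⟨tQ, tD⟩
    have fP := hfr.regs rP rfl
    have ft := hfr.regs t (by simp [writesTo, htQ, htD])
    simp [hP, htQ, htD] at fP ft
    have := Nat.lt_pow_succ_log_self (b := p) hp (σ.regs t)
    rw [Nat.succ_eq_add_one] at this
    exact ⟨by simp [fP, ft, tQ, ← pow_succ]; omega, tQ, tD⟩

theorem readBits_spec (h : RingRegs x 2 d σ) {L : List ℕ} {k : ℕ} (hs : σ.stream = L.drop k)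
    (hL : ∀ t, L.getD t 0 < 2) :
    readBits.WP B (fun τ => τ.stream = L.drop (k + d) ∧ τ.regs rC < 2 ^ d ∧
      digitSum x 2 d (τ.regs rC)
        = ∑ t ∈ Finset.range d, ((L.getD (k + t) 0 : ℕ) : A) * x ^ t) σ := by
  refine WP.of_fits fun hσ => ?_
  have hq := h.lt hσ
  have h1 := h.one_lt
  refine WP.seq <| WP.assign (by simp) <| WP.seq <| WP.assign (h1.trans hq) ?_
  refine WP.while d (fun i τ => τ.regs rW = 2 ^ i ∧ τ.regs rC < 2 ^ i ∧
    τ.stream = L.drop (k + i) ∧ digitSum x 2 i (τ.regs rC)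
        = ∑ t ∈ Finset.range i, ((L.getD (k + t) 0 : ℕ) : A) * x ^ t) ?_ ?_ ?_
  · simp [hs, digitSum_zero]
  · rintro i hi τ hfr hτ ⟨tW, tC, ts, e⟩
    have fQ := hfr.regs rQ rfl
    simp [h.regQ] at fQ
    have hid : 2 ^ i < 2 ^ d := Nat.pow_lt_pow_right (by simp) hi
    have hid' : 2 ^ (i + 1) ≤ 2 ^ d := Nat.pow_le_pow_right (by simp) hi
    have hlt := add_mul_pow_lt tC (hL (k + i))
    refine ⟨by simp [fQ, tW]; omega, ?_⟩
    refine WP.seq <| WP.read ts ((hL _).trans_le (by omega)) <| WP.seq <| WP.assign ?_ <|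
      WP.assign ?_ ?_
    · simp only [StreamState.set, StreamExpr.eval_add, StreamExpr.eval_mul, StreamExpr.eval_reg,
        Function.update_apply]
      simp only [tW, reduceIte, Fin.reduceEq]
      omega
    · simp [StreamState.set, tW, ← pow_succ]
      omega
    · have hcast : ((2 : ℕ) : A) = 0 := h.cast_eq
      refine ⟨?_, ?_, rfl, ?_⟩
      · simp [StreamState.set, tW, ← pow_succ]
      · simpa [StreamState.set, tW] using hlt
      · have := digitSum_succ_add_mul_pow (x := x) (by simp) hcast tC (L.getD (k + i) 0)
        rw [Finset.sum_range_succ, ← e, ← this]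
        simp [StreamState.set, tW]
  · rintro τ hfr hτ ⟨tW, tC, ts, e⟩
    have fQ := hfr.regs rQ rfl
    simp [h.regQ] at fQ
    exact ⟨by simp [fQ, tW], ts, tC, e⟩

/-- The counter `e` enumerates the pairs of ring elements as `(e / q, e % q)`. It reaches `q²`,
whence `hB`; by `hx` comparing numbers with `0` is a test for the zero element. -/
theorem domainTest_spec (h : RingRegs x p d σ) (hB : p ^ d * p ^ d < 2 ^ B)
    (hx : ∀ a < p ^ d, digitSum x p d a = 0 → a = 0) :
    domainTest.WP B (fun τ => τ.regs rOk ≤ 1 ∧ (τ.regs rOk = 1 ↔ ∀ e < p ^ d * p ^ d,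
      digitSum x p d (e / p ^ d) * digitSum x p d (e % p ^ d) = 0 →
        e / p ^ d = 0 ∨ e % p ^ d = 0)) σ := by
  refine WP.of_fits fun hσ => ?_
  have hq := h.lt hσ
  have h1 := h.one_lt
  refine WP.seq <| WP.assign (by simp) <| WP.seq <| WP.assign (h1.trans hq) ?_
  refine WP.while (p ^ d * p ^ d) (fun i τ => τ.regs rE = i ∧ τ.regs rOk ≤ 1 ∧
    (τ.regs rOk = 1 ↔ ∀ e < i, digitSum x p d (e / p ^ d) * digitSum x p d (e % p ^ d) = 0 →
        e / p ^ d = 0 ∨ e % p ^ d = 0)) ?_ ?_ ?_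
  · simp
  · rintro i hi τ hfr hτ ⟨tE, tOk, e⟩
    have fP := hfr.regs rP rfl
    have fQ := hfr.regs rQ rfl
    have fF := hfr.regs rF rfl
    simp at fP fQ fF
    have hdiv : i / p ^ d < p ^ d := Nat.div_lt_of_lt_mul hi
    have hmod : i % p ^ d < p ^ d := Nat.mod_lt _ (by omega)
    refine ⟨by simp [fQ, h.regQ, tE]; omega, ?_⟩
    refine WP.seq <| WP.assign (by simp) <| WP.seq <|
      WP.assign (by simp [fQ, h.regQ, tE]; omega) <| WP.seq <|
      WP.assign (by simp [fQ, h.regQ, tE]; omega) <| WP.seq ?_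
    refine WP.mono_frame (fma_spec (x := x) (p := p) (d := d)
      (h.congr (by simp [fP]) (by simp [fQ]) (by simp [fF])) (by simp; omega)
      (by simp [fQ, h.regQ, tE]; omega)) ?_
    rintro ρ hfr' hρ ⟨uC, vC⟩
    have gE := hfr'.regs rE rfl
    have gOk := hfr'.regs rOk rfl
    have gQ := hfr'.regs rQ rfl
    simp [fQ, h.regQ, tE, digitSum_zero] at gE gOk gQ vC
    have hC : ρ.regs rC = 0 ↔
        digitSum x p d (i / p ^ d) * digitSum x p d (i % p ^ d) = 0 := by
      rw [← vC]
      exact ⟨fun h => by rw [h, digitSum_zero], hx _ uC⟩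
    -- With truncated subtraction this is `0` exactly when both factors are nonzero and their
    -- product is zero, and `1` otherwise.
    generalize hval : 1 - i / p ^ d * (i % p ^ d) * (1 - ρ.regs rC) = val
    have hval1 : val ≤ 1 := by omega
    have hvaliff : val = 1 ↔ (digitSum x p d (i / p ^ d) * digitSum x p d (i % p ^ d) = 0 →
        i / p ^ d = 0 ∨ i % p ^ d = 0) := by
      rw [← hC, ← mul_eq_zero (a := i / p ^ d)]
      have : val = 1 ↔ i / p ^ d * (i % p ^ d) * (1 - ρ.regs rC) = 0 := by omega
      rw [this, Nat.mul_eq_zero]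
      constructor
      · rintro (h | h) h'
        · exact h
        · omega
      · intro h
        by_cases h' : ρ.regs rC = 0
        · exact .inl (h h')
        · right; omega
    have hmul : τ.regs rOk * val ≤ 1 := by nlinarith
    have hnew : τ.regs rOk * val = 1 ↔ ∀ e < i + 1, digitSum x p d (e / p ^ d)
        * digitSum x p d (e % p ^ d) = 0 → e / p ^ d = 0 ∨ e % p ^ d = 0 := by
      rw [Nat.forall_lt_succ_right, ← e, ← hvaliff]
      exact mul_eq_one
    refine WP.seq <| WP.assign ?_ <| WP.assign ?_ ?_
    · simp [gOk, gE, gQ, hval]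
      omega
    · simp [gE]
      omega
    · simp only [set_regs, Fin.reduceEq, reduceIte, StreamExpr.eval_add, StreamExpr.eval_mul,
        StreamExpr.eval_sub, StreamExpr.eval_div, StreamExpr.eval_mod, StreamExpr.eval_one,
        StreamExpr.eval_reg, gOk, gE, gQ, hval]
      exact ⟨trivial, hmul, hnew⟩
  · rintro τ hfr hτ ⟨tE, tOk, e⟩
    have fQ := hfr.regs rQ rfl
    simp [h.regQ] at fQ
    exact ⟨by simp [fQ, tE], tOk, e⟩

end Specs

/-! ## Codes of polynomials and field elements -/

section PolyCode

open Polynomial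

variable {p : ℕ} [hp : Fact p.Prime]

theorem sum_range_mul_pow_lt (p : ℕ) {c : ℕ → ℕ} (hc : ∀ i, c i < p) (N : ℕ) :
    ∑ i ∈ Finset.range N, c i * p ^ i < p ^ N := by
  induction N with
  | zero => simp
  | succ N ih =>
    rw [Finset.sum_range_succ]
    exact add_mul_pow_lt ih (hc N)

theorem digitSum_sum {A : Type*} [CommRing A] (x : A) {p : ℕ} (hA : (p : A) = 0) {c : ℕ → ℕ}
    (hc : ∀ i, c i < p) (N : ℕ) :
    digitSum x p N (∑ i ∈ Finset.range N, c i * p ^ i) = ∑ i ∈ Finset.range N, (c i : A) * x ^ i := by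
  induction N with
  | zero => simp [digitSum_zero]
  | succ N ih =>
    rw [Finset.sum_range_succ, digitSum_succ_add_mul_pow (by have := hc 0; omega) hA
      (sum_range_mul_pow_lt p hc N), ih, Finset.sum_range_succ]

theorem sum_digits_eq_mod (p a d : ℕ) :
    ∑ t ∈ Finset.range d, (a / p ^ t % p) * p ^ t = a % p ^ d := by
  induction d with
  | zero => simp [Nat.mod_one]
  | succ d ih => rw [Finset.sum_range_succ, ih, pow_succ, Nat.mod_mul]; ring

theorem polyCode_eq_sum {g : (ZMod p)[X]} {d : ℕ} (hg : g.natDegree < d) :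
    polyCode g = ∑ i ∈ Finset.range d, (g.coeff i).val * p ^ i := by
  refine Finset.sum_subset (fun i hi => ?_) fun i _ hi => ?_
  · simp only [Finset.mem_range] at hi ⊢; omega
  · rw [coeff_eq_zero_of_natDegree_lt (by simpa using hi)]
    simp

theorem polyCode_lt {g : (ZMod p)[X]} {d : ℕ} (hg : g.natDegree < d) : polyCode g < p ^ d := by
  rw [polyCode_eq_sum hg]
  exact sum_range_mul_pow_lt p (fun i => ZMod.val_lt _) d

theorem digitSum_polyCode {A : Type*} [CommRing A] [Algebra (ZMod p) A] (x : A)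
    {g : (ZMod p)[X]} {d : ℕ} (hg : g.natDegree < d) :
    digitSum x p d (polyCode g) = aeval x g := by
  have hA : (p : A) = 0 := by
    rw [← map_natCast (algebraMap (ZMod p) A)]; simp
  rw [polyCode_eq_sum hg, digitSum_sum x hA (fun i => ZMod.val_lt _), aeval_eq_sum_range' hg]
  refine Finset.sum_congr rfl fun i _ => ?_
  rw [Algebra.smul_def, ← map_natCast (algebraMap (ZMod p) A)]
  simp

theorem map_digitSum {A A' : Type*} [CommRing A] [CommRing A'] (φ : A →+* A') (x : A)
    (p d a : ℕ) : φ (digitSum x p d a) = digitSum (φ x) p d a := by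
  simp [digitSum]

theorem degree_digitSum_lt (d a : ℕ) : (digitSum (X : (ZMod p)[X]) p d a).degree < d := by
  refine (degree_sum_le _ _).trans_lt ((Finset.sup_lt_iff (by simp)).2 fun t ht => ?_)
  rw [← C_eq_natCast]
  exact (degree_C_mul_X_pow_le _ _).trans_lt (by simpa using ht)

theorem coeff_digitSum (d a t : ℕ) :
    (digitSum (X : (ZMod p)[X]) p d a).coeff t = if t < d then ((a / p ^ t : ℕ) : ZMod p) else 0 := by
  simp only [digitSum, ← C_eq_natCast, finsetSum_coeff, coeff_C_mul, coeff_X_pow]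
  simp

theorem polyCode_lead {f : (ZMod p)[X]} (hf : f.Monic) : p ^ f.natDegree ≤ polyCode f := by
  have : Fact (1 < p) := ⟨hp.out.one_lt⟩
  unfold polyCode
  rw [Finset.sum_range_succ, hf.coeff_natDegree, ZMod.val_one]
  omega

/-- The code of `f` has a leading digit `1` at place `p ^ deg f`; splitting it off from `f(root) =
0` leaves the relation that `RingRegs` asks for. -/
theorem digitSum_root_polyCode {f : (ZMod p)[X]} (hf : f.Monic) :
    AdjoinRoot.root f ^ f.natDegree
      + digitSum (AdjoinRoot.root f) p f.natDegree (polyCode f) = 0 := by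
  have h := digitSum_polyCode (AdjoinRoot.root f) (Nat.lt_succ_self f.natDegree)
  have : Fact (1 < p) := ⟨hp.out.one_lt⟩
  have hlt := polyCode_lt (Nat.lt_succ_self f.natDegree)
  have hle := polyCode_lead hf
  have h1 : ((polyCode f / p ^ f.natDegree : ℕ) : ZMod p) = 1 := by
    have := coeff_digitSum (p := p) (f.natDegree + 1) (polyCode f) f.natDegree
    rw [digitSum_polyCode X (Nat.lt_succ_self f.natDegree)] at this
    simpa [hf.coeff_natDegree] using this.symm
  have h1' : ((polyCode f / p ^ f.natDegree : ℕ) : AdjoinRoot f) = 1 := by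
    rw [← map_natCast (algebraMap (ZMod p) (AdjoinRoot f)), h1, map_one]
  rw [digitSum_succ, h1', AdjoinRoot.aeval_eq, AdjoinRoot.mk_self] at h
  linear_combination h

theorem digitSum_root_eq_mk (f : (ZMod p)[X]) (d a : ℕ) :
    digitSum (AdjoinRoot.root f) p d a = AdjoinRoot.mk f (digitSum X p d a) := by
  rw [map_digitSum]; rfl

theorem digitSum_fieldCode {f : (ZMod p)[X]} (hf : f.Monic) (hd : 1 ≤ f.natDegree)
    (y : AdjoinRoot f) :
    fieldCode hf y < p ^ f.natDegree ∧
      digitSum (AdjoinRoot.root f) p f.natDegree (fieldCode hf y) = y := by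
  have hdeg : (AdjoinRoot.modByMonicHom hf y).natDegree < f.natDegree := by
    obtain ⟨g, rfl⟩ := AdjoinRoot.mk_surjective y
    rw [AdjoinRoot.modByMonicHom_mk]
    exact natDegree_modByMonic_lt _ hf (by rintro rfl; simp at hd)
  refine ⟨polyCode_lt hdeg, ?_⟩
  rw [fieldCode, digitSum_polyCode _ hdeg, AdjoinRoot.aeval_eq, AdjoinRoot.mk_leftInverse hf]

/-- A digit polynomial of degree below `deg f` is its own remainder modulo `f`, so the digits can be
read off as its coefficients. -/
theorem digitSum_root_inj {f : (ZMod p)[X]} (hf : f.Monic) {a b : ℕ} (ha : a < p ^ f.natDegree)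
    (hb : b < p ^ f.natDegree) (h : digitSum (AdjoinRoot.root f) p f.natDegree a =
      digitSum (AdjoinRoot.root f) p f.natDegree b) : a = b := by
  have hd : degree f = f.natDegree := degree_eq_natDegree hf.ne_zero
  have h' := congrArg (AdjoinRoot.modByMonicHom hf) h
  rw [digitSum_root_eq_mk, digitSum_root_eq_mk, AdjoinRoot.modByMonicHom_mk,
    AdjoinRoot.modByMonicHom_mk, (modByMonic_eq_self_iff hf).2 (hd ▸ degree_digitSum_lt _ _),
    (modByMonic_eq_self_iff hf).2 (hd ▸ degree_digitSum_lt _ _)] at h'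
  rw [← Nat.mod_eq_of_lt ha, ← Nat.mod_eq_of_lt hb, ← sum_digits_eq_mod, ← sum_digits_eq_mod]
  refine Finset.sum_congr rfl fun t ht => ?_
  have := congrArg (fun g => g.coeff t) h'
  simp only [coeff_digitSum, Finset.mem_range.1 ht, if_true] at this
  rw [(ZMod.natCast_eq_natCast_iff' _ _ _).1 this]

theorem digitSum_root_eq_zero {f : (ZMod p)[X]} (hf : f.Monic) {a : ℕ}
    (ha : a < p ^ f.natDegree) (h : digitSum (AdjoinRoot.root f) p f.natDegree a = 0) :
    a = 0 :=
  digitSum_root_inj hf ha (pow_pos hp.out.pos _) (h.trans (digitSum_zero _).symm)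

/-- A proper monic factorization of `f` yields zero divisors in the quotient, and these have nonzero
codes below `q`. This makes irreducibility a finite search that `domainTest` can carry out. -/
theorem irreducible_iff_forall_digitSum {f : (ZMod p)[X]} (hf : f.Monic)
    (hd : 1 ≤ f.natDegree) :
    Irreducible f ↔ ∀ e < p ^ f.natDegree * p ^ f.natDegree,
      digitSum (AdjoinRoot.root f) p f.natDegree (e / p ^ f.natDegree)
        * digitSum (AdjoinRoot.root f) p f.natDegree (e % p ^ f.natDegree) = 0 →
      e / p ^ f.natDegree = 0 ∨ e % p ^ f.natDegree = 0 := by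
  have hq : 0 < p ^ f.natDegree := pow_pos hp.out.pos _
  constructor
  · intro hi e he h0
    have : Fact (Irreducible f) := ⟨hi⟩
    rcases mul_eq_zero.1 h0 with h | h
    · exact .inl (digitSum_root_eq_zero hf (Nat.div_lt_of_lt_mul he) h)
    · exact .inr (digitSum_root_eq_zero hf (Nat.mod_lt _ hq) h)
  · intro H
    by_contra hi
    have h1 : f ≠ 1 := by rintro rfl; simp at hd
    rw [hf.irreducible_iff_natDegree' ] at hi
    push Not at hi
    obtain ⟨g, h, hg, hh, rfl, hmem⟩ := hi h1
    rw [Finset.mem_Ioc] at hmem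
    set f := g * h
    have hfd : f.natDegree = g.natDegree + h.natDegree := hg.natDegree_mul hh
    have hgd : g.natDegree < f.natDegree := by omega
    have hhd : h.natDegree < f.natDegree := by omega
    have lg := polyCode_lt hgd
    have lh := polyCode_lt hhd
    have pg : 0 < polyCode g := (pow_pos hp.out.pos _).trans_le (polyCode_lead hg)
    have ph : 0 < polyCode h := (pow_pos hp.out.pos _).trans_le (polyCode_lead hh)
    have e1 : (polyCode h + p ^ f.natDegree * polyCode g) / p ^ f.natDegree = polyCode g := by
      rw [Nat.add_mul_div_left _ _ hq, Nat.div_eq_of_lt lh, zero_add]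
    have e2 : (polyCode h + p ^ f.natDegree * polyCode g) % p ^ f.natDegree = polyCode h := by
      rw [Nat.add_mul_mod_self_left, Nat.mod_eq_of_lt lh]
    -- The number of the pair `(g, h)` in the enumeration by quotient and remainder.
    have := H (polyCode h + p ^ f.natDegree * polyCode g) (by nlinarith) (by
      rw [e1, e2, digitSum_polyCode _ hgd, digitSum_polyCode _ hhd, ← map_mul,
        AdjoinRoot.aeval_eq, AdjoinRoot.mk_self])
    rw [e1, e2] at this
    omega

/-- The monic polynomial of degree `d` whose other coefficients are the digits of `F`. -/
noncomputable def digitPoly (p d F : ℕ) : (ZMod p)[X] := X ^ d + digitSum X p d F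

theorem digitPoly_monic (d F : ℕ) : (digitPoly p d F).Monic :=
  monic_X_pow_add (degree_digitSum_lt d F)

theorem digitPoly_natDegree (d F : ℕ) : (digitPoly p d F).natDegree = d :=
  natDegree_eq_of_degree_eq_some <| by
    rw [digitPoly, degree_add_eq_left_of_degree_lt] <;> rw [degree_X_pow]
    exact degree_digitSum_lt d F

theorem digitPoly_root (d F : ℕ) :
    AdjoinRoot.root (digitPoly p d F) ^ d
      + digitSum (AdjoinRoot.root (digitPoly p d F)) p d F = 0 := by
  rw [digitSum_root_eq_mk, ← AdjoinRoot.mk_X, ← map_pow, ← map_add]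
  exact AdjoinRoot.mk_self

/-- The leading digit of the code is cut off by taking only `deg f` digits and restored by the
summand `X ^ d`. -/
theorem digitPoly_polyCode {f : (ZMod p)[X]} (hf : f.Monic) :
    digitPoly p f.natDegree (polyCode f) = f := by
  have h := digitSum_polyCode (X : (ZMod p)[X]) (Nat.lt_succ_self f.natDegree)
  rw [aeval_X_left_apply] at h
  ext t
  rw [digitPoly, coeff_add, coeff_digitSum, coeff_X_pow]
  split_ifs with h1 h2 h2
  · omega
  · rw [h1, hf.coeff_natDegree, add_zero]
  · conv_rhs => rw [← h, coeff_digitSum]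
    simp [h2.trans (Nat.lt_succ_self _)]
  · rw [coeff_eq_zero_of_natDegree_lt (by omega), add_zero]

/-- The minimal polynomial of a primitive element of the field with `p ^ d` elements qualifies. For
`p = 2` this makes the search halt within `d + 1` bits. -/
theorem exists_irreducible_digitPoly {d : ℕ} (hd : 1 ≤ d) :
    ∃ F, p ^ d ≤ F ∧ F < p ^ (d + 1) ∧ Irreducible (digitPoly p d F) := by
  have : Algebra.IsSeparable (ZMod p) (GaloisField p d) := inferInstance
  obtain ⟨a, ha⟩ := Field.exists_primitive_element (ZMod p) (GaloisField p d)
  have hint : IsIntegral (ZMod p) a := Algebra.IsIntegral.isIntegral a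
  have hdeg : (minpoly (ZMod p) a).natDegree = d := by
    rw [Field.primitive_element_iff_minpoly_natDegree_eq] at ha
    rw [ha, GaloisField.finrank p (by omega)]
  have hm := minpoly.monic hint
  refine ⟨polyCode (minpoly (ZMod p) a), ?_, polyCode_lt (by omega), ?_⟩
  · simpa [hdeg] using polyCode_lead hm
  · have := digitPoly_polyCode hm
    rw [hdeg] at this
    rw [this]
    exact minpoly.irreducible hint

end PolyCode

/-! ## The error detectors -/

/-- Start of the main loop, after the size of the field has been computed. -/
def startLoop : StreamProg 24 :=
  tossPoint ;; rOk ::= 1 ;; rSum ::= 0 ;; rJ ::= 0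

/-- Accept if the sum is zero and no check failed. -/
def decideSum : StreamProg 24 := rN ::= (1 - V rSum) * V rOk

/-- The error detector for Reed-Solomon codes. -/
def reedSolomonDetector : StreamProg 24 :=
  fieldSize rF ;;
  rBlocks ::= V rN ;; rChecks ::= V rN / 4 ;;
  startLoop ;;
  .while (V rBlocks - V rJ) (.read rY ;; accumulate ;; rJ ::= V rJ + 1) ;;
  decideSum

/-- Search the first irreducible polynomial of degree `d` over `𝔽₂`, where `q = 2 ^ d`. -/
def searchField : StreamProg 24 :=
  rF ::= V rQ - 1 ;; rOk ::= 0 ;;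
  .while (1 - V rOk) (rF ::= V rF + 1 ;; domainTest)

/-- Read a block `(y, z)`, check that `z = j y` for the field element number `j`, and add the
contribution of `y` to the sum. -/
def readBlock : StreamProg 24 :=
  readBits ;; rY ::= V rC ;; readBits ;; rZ ::= V rC ;;
  rC ::= 0 ;; rA ::= V rY ;; rB ::= V rJ ;; fma ;;
  rOk ::= V rOk * (1 - (V rC - V rZ) - (V rZ - V rC)) ;;
  accumulate ;; rJ ::= V rJ + 1

/-- The error detector for Justesen codes. -/
def justesenDetector : StreamProg 24 :=
  .ite (.const (2 ^ 40) - V rN) (rN ::= 1) (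
    rP ::= 2 ;; fieldSize rN ;; searchField ;;
    rBlocks ::= V rN / (2 * V rD) + 1 ;; rChecks ::= V rBlocks / 4 ;;
    startLoop ;;
    .while (V rBlocks - V rJ) readBlock ;;
    decideSum)

/-- The number written by coins, with the least significant bit first. -/
def coinNumber (l : List Bool) : ℕ := Nat.ofDigits 2 (l.map Bool.toNat)

theorem coinNumber_lt (l : List Bool) : coinNumber l < 2 ^ l.length := by
  have := Nat.ofDigits_lt_base_pow_length (b := 2) (l := l.map Bool.toNat) (by simp)
    (by
      intro a ha
      obtain ⟨b, -, rfl⟩ := List.mem_map.1 ha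
      exact Bool.toNat_lt b)
  simpa [coinNumber] using this

/-! ### Correctness of the two detectors -/

section Specs

variable {A : Type*} [CommRing A] {x : A} {p d B : ℕ} {σ τ : StreamState 24}

theorem startLoop_spec {q : ℕ} (hq : 1 < q) (hQ : σ.regs rQ = q)
    (hc : σ.coins.length = Nat.log 2 q) :
    startLoop.WP B (fun τ => τ.regs rPoint = coinNumber σ.coins ∧ τ.regs rOk = 1 ∧
      τ.regs rSum = 0 ∧ τ.regs rJ = 0) σ := by
  refine WP.of_fits fun hσ => ?_
  have hB := hq.trans (hQ ▸ hσ rQ)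
  refine WP.seq <| WP.mono_frame (tossPoint_spec hq hQ hc) ?_
  intro τ _ _ hR
  exact WP.seq <| WP.assign hB <| WP.seq <| WP.assign (by simp) <| WP.assign (by simp)
    (by simp [hR, coinNumber])

theorem decideSum_spec :
    decideSum.WP B (fun τ => τ.regs rN = 1 ↔ σ.regs rSum = 0 ∧ σ.regs rOk = 1) σ := by
  refine WP.of_fits fun hσ => ?_
  have hB := hσ rOk
  have h1 : (1 - σ.regs rSum) * σ.regs rOk ≤ σ.regs rOk :=
    (Nat.mul_le_mul_right _ (Nat.sub_le 1 _)).trans (by simp)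
  refine WP.assign ?_ ?_
  · simp
    omega
  · simp
    omega

theorem reedSolomonDetector_spec {n F : ℕ} {L : List ℕ} (hp : 2 ≤ p) (hd : 1 ≤ d)
    (hA : (p : A) = 0) (hroot : x ^ d + digitSum x p d F = 0) (hlog : Nat.log p F = d)
    (hx : ∀ a < p ^ d, digitSum x p d a = 0 → a = 0)
    (hL : ∀ t, L.getD t 0 < p ^ d) (hN : σ.regs rN = n) (hP : σ.regs rP = p)
    (hF : σ.regs rF = F) (hs : σ.stream = L) (hc : σ.coins.length = Nat.log 2 (p ^ d)) :
    reedSolomonDetector.WP B (fun τ => τ.regs rN = 1 ↔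
      ∑ j ∈ Finset.range n, digitSum x p d (L.getD j 0) * ∑ i ∈ Finset.range (n / 4),
        (digitSum x p d (coinNumber σ.coins) * digitSum x p d j) ^ i = 0) σ := by
  refine WP.of_fits fun hσ => ?_
  have hNB := hσ rN
  have h1 : 1 < p ^ d := Nat.one_lt_pow (by omega) hp
  have hF1 : 1 ≤ F := by
    rcases Nat.eq_zero_or_pos F with rfl | h
    · simp at hlog; omega
    · exact h
  refine WP.seq <| WP.mono_frame (fieldSize_spec (by decide) (by decide) hp hP (hF ▸ hF1)) ?_
  rintro τ₁ fr₁ hτ₁ ⟨hQ₁, -⟩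
  rw [hF, hlog] at hQ₁
  have N₁ := (fr₁.regs rN rfl).trans hN
  have P₁ := (fr₁.regs rP rfl).trans hP
  have F₁ := (fr₁.regs rF rfl).trans hF
  have s₁ := (fr₁.stream rfl).trans hs
  have c₁ := fr₁.coins rfl
  clear fr₁
  refine WP.seq <| WP.assign (by simp [N₁]; omega) <| WP.seq <|
    WP.assign (by simp [N₁]; omega) <| WP.seq ?_
  refine WP.mono_frame (startLoop_spec h1 (by simp [hQ₁]) (by simp [c₁, hc])) ?_
  rintro τ₂ fr₂ hτ₂ ⟨R₂, Ok₂, S₂, J₂⟩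
  have P₂ := fr₂.regs rP rfl
  have Q₂ := fr₂.regs rQ rfl
  have F₂ := fr₂.regs rF rfl
  have M₂ := fr₂.regs rBlocks rfl
  have K₂ := fr₂.regs rChecks rfl
  have s₂ := fr₂.stream rfl
  simp [N₁, P₁, hQ₁, F₁, s₁, c₁] at P₂ Q₂ F₂ M₂ K₂ s₂ R₂
  clear fr₂
  have hR : coinNumber σ.coins < p ^ d :=
    (coinNumber_lt _).trans_le (hc ▸ Nat.pow_log_le_self 2 (by omega))
  have hQB : p ^ d < 2 ^ B := Q₂ ▸ hτ₂ rQ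
  refine WP.seq <| WP.while n (fun j τ => τ.regs rJ = j ∧ τ.stream = L.drop j ∧
    τ.regs rSum < p ^ d ∧ digitSum x p d (τ.regs rSum) =
      ∑ j ∈ Finset.range j, digitSum x p d (L.getD j 0) * ∑ i ∈ Finset.range (n / 4),
        (digitSum x p d (coinNumber σ.coins) * digitSum x p d j) ^ i) ?_ ?_ ?_
  · simp [J₂, s₂, S₂, digitSum_zero]
    omega
  · rintro j hj τ fr hτ ⟨tJ, ts, tS, e⟩
    have P₃ := (fr.regs rP rfl).trans P₂
    have Q₃ := (fr.regs rQ rfl).trans Q₂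
    have F₃ := (fr.regs rF rfl).trans F₂
    have M₃ := (fr.regs rBlocks rfl).trans M₂
    have K₃ := (fr.regs rChecks rfl).trans K₂
    have R₃ := (fr.regs rPoint rfl).trans R₂
    refine ⟨by simp [tJ, M₃]; omega, ?_⟩
    refine WP.seq <| WP.read ts ((hL j).trans hQB) <| WP.seq ?_
    refine WP.mono_frame (accumulate_spec (x := x) (p := p) (d := d)
      ⟨hp, hd, hA, by simp [StreamState.set, P₃], by simp [StreamState.set, Q₃],
        by simpa [StreamState.set, F₃] using hroot⟩
      (by simpa [StreamState.set, R₃] using hR) (by simpa [StreamState.set] using tS)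
      (by simpa [StreamState.set] using hL j)) ?_
    rintro ρ fr' hρ ⟨uS, uE⟩
    have J₄ := fr'.regs rJ rfl
    have s₄ := fr'.stream rfl
    simp [StreamState.set, tJ] at J₄ s₄
    simp [StreamState.set, K₃, R₃, tJ, e] at uE
    refine WP.assign (by simp [J₄]; omega) ?_
    simp [J₄, s₄, uS, uE, Finset.sum_range_succ]
  · rintro τ fr hτ ⟨tJ, ts, tS, e⟩
    have M₃ := (fr.regs rBlocks rfl).trans M₂
    have Ok₃ := (fr.regs rOk rfl).trans Ok₂
    refine ⟨by simp [tJ, M₃], ?_⟩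
    refine WP.mono_frame decideSum_spec ?_
    intro ρ _ _ h
    rw [h, Ok₃, ← e]
    simp only [and_true]
    -- The program tests the number in the register; as it is below `p ^ d`, it is `0` exactly when
    -- the field element is.
    exact ⟨fun h => by rw [h, digitSum_zero], hx _ tS⟩

/-- The least number of an irreducible polynomial of degree `d` over `𝔽₂`. -/
noncomputable def fieldNumber (d : ℕ) : ℕ :=
  sInf {F | 2 ^ d ≤ F ∧ Irreducible (digitPoly 2 d F)}

theorem fieldNumber_spec (hd : 1 ≤ d) :
    2 ^ d ≤ fieldNumber d ∧ fieldNumber d < 2 ^ (d + 1) ∧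
      Irreducible (digitPoly 2 d (fieldNumber d)) := by
  obtain ⟨F, h1, h2, h3⟩ := exists_irreducible_digitPoly (p := 2) hd
  have hmem := Nat.sInf_mem (s := {F | 2 ^ d ≤ F ∧ Irreducible (digitPoly 2 d F)}) ⟨F, h1, h3⟩
  refine ⟨hmem.1, lt_of_le_of_lt ?_ h2, hmem.2⟩
  exact Nat.sInf_le (show F ∈ {F | 2 ^ d ≤ F ∧ Irreducible (digitPoly 2 d F)} from ⟨h1, h3⟩)

theorem irreducible_digitPoly_iff [Fact p.Prime] (hd : 1 ≤ d) (F : ℕ) :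
    Irreducible (digitPoly p d F) ↔ ∀ e < p ^ d * p ^ d,
      digitSum (AdjoinRoot.root (digitPoly p d F)) p d (e / p ^ d)
        * digitSum (AdjoinRoot.root (digitPoly p d F)) p d (e % p ^ d) = 0 →
      e / p ^ d = 0 ∨ e % p ^ d = 0 := by
  have := irreducible_iff_forall_digitSum (digitPoly_monic (p := p) d F)
    (by rwa [digitPoly_natDegree])
  simpa only [digitPoly_natDegree] using this

theorem digitPoly_root_eq_zero [Fact p.Prime] (d F : ℕ) {a : ℕ} (ha : a < p ^ d)
    (h : digitSum (AdjoinRoot.root (digitPoly p d F)) p d a = 0) : a = 0 :=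
  digitSum_root_eq_zero (digitPoly_monic (p := p) d F) (by rwa [digitPoly_natDegree])
    (by rwa [digitPoly_natDegree])

theorem digitPoly_cast_eq_zero (p d F : ℕ) : (p : AdjoinRoot (digitPoly p d F)) = 0 := by
  rw [← map_natCast (algebraMap (ZMod p) _)]
  simp

theorem searchField_spec (hd : 1 ≤ d) (hB : 2 ^ d * 2 ^ d < 2 ^ B) (hP : σ.regs rP = 2)
    (hQ : σ.regs rQ = 2 ^ d) :
    searchField.WP B (fun τ => τ.regs rF = fieldNumber d) σ := by
  obtain ⟨hle, hlt, hirr⟩ := fieldNumber_spec hd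
  have h1 : 2 ≤ 2 ^ d := by simpa using Nat.pow_le_pow_right (n := 2) (by simp) hd
  have hFB : fieldNumber d < 2 ^ B := by
    rw [pow_succ] at hlt
    nlinarith
  refine WP.of_fits fun hσ => ?_
  have hQB := hσ rQ
  refine WP.seq <| WP.assign (by simp; omega) <| WP.seq <| WP.assign (by simp) ?_
  -- `F` starts at `2 ^ d - 1`, one before the first candidate, since the loop increments before it
  -- tests.
  refine WP.while (fieldNumber d + 1 - 2 ^ d) (fun i τ => τ.regs rF + 1 = 2 ^ d + i ∧
    τ.regs rOk ≤ 1 ∧ (τ.regs rOk = 1 ↔ τ.regs rF = fieldNumber d)) ?_ ?_ ?_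
  · simp [hQ]
    omega
  · rintro i hi τ fr hτ ⟨tF, tOk, e⟩
    have P₁ := fr.regs rP rfl
    have Q₁ := fr.regs rQ rfl
    simp [hP, hQ] at P₁ Q₁
    refine ⟨by simp; omega, ?_⟩
    refine WP.seq <| WP.assign (by simp; omega) ?_
    -- Every round is interpreted in a different ring, the quotient by the current candidate.
    refine WP.mono_frame (domainTest_spec (p := 2) (d := d)
      (x := AdjoinRoot.root (digitPoly 2 d (τ.regs rF + 1)))
      ⟨le_rfl, hd, digitPoly_cast_eq_zero _ _ _, by simp [P₁], by simp [Q₁],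
        by simpa using digitPoly_root d _⟩ hB fun a ha => digitPoly_root_eq_zero d _ ha) ?_
    rintro ρ fr' hρ ⟨uOk, uE⟩
    have F₂ := fr'.regs rF rfl
    simp at F₂
    rw [← irreducible_digitPoly_iff hd] at uE
    refine ⟨by omega, uOk, ?_⟩
    rw [uE, F₂]
    constructor
    · intro h
      have : fieldNumber d ≤ τ.regs rF + 1 := Nat.sInf_le ⟨by omega, h⟩
      omega
    · intro h
      rwa [h]
  · rintro τ fr hτ ⟨tF, tOk, e⟩
    have hF : τ.regs rF = fieldNumber d := by omega
    exact ⟨by simp [e.2 hF], hF⟩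

/-- The field element with the digits `L k, …, L (k + d - 1)`. -/
def blockSum (x : A) (d : ℕ) (L : ℕ → A) (k : ℕ) : A :=
  ∑ t ∈ Finset.range d, L (k + t) * x ^ t

theorem readBlock_spec (h : RingRegs x 2 d σ) (hx : ∀ a < 2 ^ d, ∀ b < 2 ^ d,
      digitSum x 2 d a = digitSum x 2 d b → a = b) {L : List ℕ} {k : ℕ}
    (hs : σ.stream = L.drop k) (hL : ∀ t, L.getD t 0 < 2) (hR : σ.regs rPoint < 2 ^ d)
    (hS : σ.regs rSum < 2 ^ d) (hOk : σ.regs rOk ≤ 1) (hJ : σ.regs rJ + 1 < 2 ^ B) :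
    readBlock.WP B (fun τ => τ.stream = L.drop (k + 2 * d) ∧ τ.regs rJ = σ.regs rJ + 1 ∧
      τ.regs rOk ≤ 1 ∧ (τ.regs rOk = 1 ↔ σ.regs rOk = 1 ∧
        blockSum x d (fun t => (L.getD t 0 : A)) (k + d)
          = blockSum x d (fun t => (L.getD t 0 : A)) k * digitSum x 2 d (σ.regs rJ)) ∧
      τ.regs rSum < 2 ^ d ∧ digitSum x 2 d (τ.regs rSum) = digitSum x 2 d (σ.regs rSum)
        + blockSum x d (fun t => (L.getD t 0 : A)) k * ∑ i ∈ Finset.range (σ.regs rChecks),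
          (digitSum x 2 d (σ.regs rPoint) * digitSum x 2 d (σ.regs rJ)) ^ i) σ := by
  refine WP.of_fits fun hσ => ?_
  have hq := h.lt hσ
  refine WP.seq <| WP.mono_frame (readBits_spec h hs hL) ?_
  rintro τ₁ fr₁ hτ₁ ⟨s₁, C₁, e₁⟩
  have P₁ := fr₁.regs rP rfl
  have Q₁ := fr₁.regs rQ rfl
  have F₁ := fr₁.regs rF rfl
  have K₁ := fr₁.regs rChecks rfl
  have R₁ := fr₁.regs rPoint rfl
  have S₁ := fr₁.regs rSum rfl
  have J₁ := fr₁.regs rJ rfl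
  have Ok₁ := fr₁.regs rOk rfl
  clear fr₁
  refine WP.seq <| WP.assign (by simp; omega) <| WP.seq ?_
  refine WP.mono_frame (readBits_spec (x := x) (h.congr (by simp [P₁]) (by simp [Q₁])
    (by simp [F₁])) (by simpa using s₁) hL) ?_
  rintro τ₂ fr₂ hτ₂ ⟨s₂, C₂, e₂⟩
  have P₂ := fr₂.regs rP rfl
  have Q₂ := fr₂.regs rQ rfl
  have F₂ := fr₂.regs rF rfl
  have K₂ := fr₂.regs rChecks rfl
  have R₂ := fr₂.regs rPoint rfl
  have S₂ := fr₂.regs rSum rfl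
  have J₂ := fr₂.regs rJ rfl
  have Ok₂ := fr₂.regs rOk rfl
  have Y₂ := fr₂.regs rY rfl
  simp [P₁, Q₁, F₁, K₁, R₁, S₁, J₁, Ok₁] at P₂ Q₂ F₂ K₂ R₂ S₂ J₂ Ok₂ Y₂
  clear fr₂
  refine WP.seq <| WP.assign (by simp; omega) <| WP.seq <| WP.assign (by simp) <|
    WP.seq <| WP.assign (by simp; omega) <| WP.seq <| WP.assign (by simp; omega) <| WP.seq ?_
  refine WP.mono_frame (fma_spec (x := x) (p := 2) (d := d) (h.congr (by simp [P₂])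
    (by simp [Q₂]) (by simp [F₂])) (by simp) (by simp; omega)) ?_
  rintro τ₃ fr₃ hτ₃ ⟨C₃, e₃⟩
  have P₃ := fr₃.regs rP rfl
  have Q₃ := fr₃.regs rQ rfl
  have F₃ := fr₃.regs rF rfl
  have K₃ := fr₃.regs rChecks rfl
  have R₃ := fr₃.regs rPoint rfl
  have S₃ := fr₃.regs rSum rfl
  have J₃ := fr₃.regs rJ rfl
  have Ok₃ := fr₃.regs rOk rfl
  have Y₃ := fr₃.regs rY rfl
  have Z₃ := fr₃.regs rZ rfl
  have s₃ := fr₃.stream rfl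
  simp [P₂, Q₂, F₂, K₂, R₂, S₂, J₂, Ok₂, Y₂, s₂] at P₃ Q₃ F₃ K₃ R₃ S₃ J₃ Ok₃ Y₃ Z₃ s₃
  simp [Y₂, J₂, digitSum_zero] at e₃
  clear fr₃
  have hCZ : τ₃.regs rC = τ₂.regs rC ↔ blockSum x d (fun t => (L.getD t 0 : A)) (k + d)
          = blockSum x d (fun t => (L.getD t 0 : A)) k * digitSum x 2 d (σ.regs rJ) := by
    rw [blockSum, blockSum, ← e₂, ← e₁, ← e₃]
    exact ⟨fun h => by rw [h], fun h => (hx _ C₂ _ C₃ h).symm⟩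
  -- Subtracting both truncated differences tests equality: the value is `1` if the two numbers
  -- agree and `0` otherwise.
  generalize hval : 1 - (τ₃.regs rC - τ₂.regs rC) - (τ₂.regs rC - τ₃.regs rC) = val
  have hval1 : val ≤ 1 := by omega
  have hvaliff : val = 1 ↔ τ₃.regs rC = τ₂.regs rC := by omega
  have hmul : σ.regs rOk * val ≤ 1 := (Nat.mul_le_mul hOk hval1).trans (by simp)
  refine WP.seq <| WP.assign (by simp [Ok₃, Z₃, hval]; omega) <| WP.seq ?_
  refine WP.mono_frame (accumulate_spec (x := x) (p := 2) (d := d) (h.congr (by simp [P₃])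
    (by simp [Q₃]) (by simp [F₃])) (by simp; omega) (by simp; omega) (by simp; omega)) ?_
  rintro τ₄ fr₄ hτ₄ ⟨S₄, e₄⟩
  have J₄ := fr₄.regs rJ rfl
  have Ok₄ := fr₄.regs rOk rfl
  have s₄ := fr₄.stream rfl
  simp [J₃, Ok₃, s₃, Z₃, hval] at J₄ Ok₄ s₄
  simp [S₃, Y₃, K₃, R₃, J₃] at e₄
  refine WP.assign (by simp; omega) ?_
  simp only [set_regs, set_stream, Fin.reduceEq, reduceIte, StreamExpr.eval_add,
    StreamExpr.eval_one, StreamExpr.eval_reg, J₄, Ok₄, s₄, e₄, mul_eq_one, hvaliff, hCZ]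
  exact ⟨by congr 1; ring, trivial, hmul, trivial, S₄, by rw [e₁]; rfl⟩

end Specs

/-- The polynomial that defines the field of a Justesen code with `2 ^ d` field elements. -/
noncomputable abbrev justesenPoly (d : ℕ) : Polynomial (ZMod 2) := digitPoly 2 d (fieldNumber d)

theorem justesenDetector_small {n B : ℕ} {σ : StreamState 24} (hN : σ.regs rN = n)
    (hn : n < 2 ^ 40) (hB : 1 ≤ B) : justesenDetector.WP B (fun τ => τ.regs rN = 1) σ := by
  refine WP.ite (fun _ => WP.assign ?_ (by simp)) fun h => ?_
  · simp
    omega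
  · simp [hN] at h
    omega

theorem justesenDetector_spec {n d B : ℕ} {σ : StreamState 24} {L : List ℕ}
    (hN : σ.regs rN = n) (hn : 2 ^ 40 ≤ n) (hd : d = Nat.log 2 n) (hB : 2 ^ d * 2 ^ d < 2 ^ B)
    (hs : σ.stream = L) (hL : ∀ t, L.getD t 0 < 2) (hc : σ.coins.length = d)
    (x : AdjoinRoot (justesenPoly d)) (hx : x = AdjoinRoot.root _) :
    justesenDetector.WP B (fun τ => τ.regs rN = 1 ↔
      (∀ j < n / (2 * d) + 1, blockSum x d (fun t => (L.getD t 0 : AdjoinRoot (justesenPoly d)))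
            (2 * d * j + d)
          = blockSum x d (fun t => (L.getD t 0 : AdjoinRoot (justesenPoly d))) (2 * d * j)
            * digitSum x 2 d j) ∧
      ∑ j ∈ Finset.range (n / (2 * d) + 1),
        blockSum x d (fun t => (L.getD t 0 : AdjoinRoot (justesenPoly d))) (2 * d * j)
          * ∑ i ∈ Finset.range ((n / (2 * d) + 1) / 4),
            (digitSum x 2 d (coinNumber σ.coins) * digitSum x 2 d j) ^ i = 0) σ := by
  subst hx
  refine WP.of_fits fun hσ => ?_
  have hNB := hσ rN
  have hd1 : 1 ≤ d := by
    rw [hd]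
    exact Nat.log_pos (by simp) (by omega)
  have h1 : 1 < 2 ^ d := Nat.one_lt_pow (by omega) (by simp)
  have hNd : n / (2 * d) + 1 ≤ n := by
    have : n / (2 * d) ≤ n / 2 := Nat.div_le_div_left (by omega) (by simp)
    omega
  refine WP.ite (fun h => ?_) fun _ => ?_
  · simp [hN] at h
    omega
  refine WP.seq <| WP.assign (by simp; omega) <| WP.seq ?_
  refine WP.mono_frame (fieldSize_spec (p := 2) (by decide) (by decide) le_rfl (by simp)
    (by simp; omega)) ?_
  rintro τ₁ fr₁ hτ₁ ⟨Q₁, D₁⟩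
  have N₁ := fr₁.regs rN rfl
  have P₁ := fr₁.regs rP rfl
  have s₁ := fr₁.stream rfl
  have c₁ := fr₁.coins rfl
  simp [hN, hs, ← hd] at N₁ P₁ s₁ c₁ Q₁ D₁
  clear fr₁
  refine WP.seq <| WP.mono_frame (searchField_spec hd1 hB P₁ Q₁) ?_
  rintro τ₂ fr₂ hτ₂ F₂
  have N₂ := (fr₂.regs rN rfl).trans N₁
  have P₂ := (fr₂.regs rP rfl).trans P₁
  have Q₂ := (fr₂.regs rQ rfl).trans Q₁
  have D₂ := (fr₂.regs rD rfl).trans D₁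
  have s₂ := (fr₂.stream rfl).trans s₁
  have c₂ := (fr₂.coins rfl).trans c₁
  clear fr₂
  refine WP.seq <| WP.assign (by simp [N₂, D₂]; omega) <| WP.seq <|
    WP.assign (by simp [N₂, D₂]; omega) <| WP.seq ?_
  refine WP.mono_frame (startLoop_spec h1 (by simp [Q₂])
    (by simp [c₂, hc, Nat.log_pow])) ?_
  rintro τ₃ fr₃ hτ₃ ⟨R₃, Ok₃, S₃, J₃⟩
  have P₃ := fr₃.regs rP rfl
  have Q₃ := fr₃.regs rQ rfl
  have F₃ := fr₃.regs rF rfl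
  have M₃ := fr₃.regs rBlocks rfl
  have K₃ := fr₃.regs rChecks rfl
  have s₃ := fr₃.stream rfl
  simp [N₂, P₂, Q₂, F₂, D₂, s₂, c₂] at P₃ Q₃ F₃ M₃ K₃ s₃ R₃
  clear fr₃
  have hR : coinNumber σ.coins < 2 ^ d := hc ▸ coinNumber_lt _
  refine WP.seq <| WP.while (n / (2 * d) + 1) (fun j τ => τ.regs rJ = j ∧
    τ.stream = L.drop (2 * d * j) ∧ τ.regs rOk ≤ 1 ∧ τ.regs rSum < 2 ^ d ∧
    (τ.regs rOk = 1 ↔ ∀ i < j, blockSum (AdjoinRoot.root _) d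
        (fun t => (L.getD t 0 : AdjoinRoot (justesenPoly d))) (2 * d * i + d)
      = blockSum (AdjoinRoot.root _) d
        (fun t => (L.getD t 0 : AdjoinRoot (justesenPoly d))) (2 * d * i)
        * digitSum (AdjoinRoot.root _) 2 d i) ∧
    digitSum (AdjoinRoot.root (justesenPoly d)) 2 d (τ.regs rSum) = ∑ j ∈ Finset.range j,
        blockSum (AdjoinRoot.root _) d
          (fun t => (L.getD t 0 : AdjoinRoot (justesenPoly d))) (2 * d * j)
          * ∑ i ∈ Finset.range ((n / (2 * d) + 1) / 4),
            (digitSum (AdjoinRoot.root _) 2 d (coinNumber σ.coins)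
              * digitSum (AdjoinRoot.root _) 2 d j) ^ i) ?_ ?_ ?_
  · simp [J₃, s₃, Ok₃, S₃, digitSum_zero]
  · rintro j hj τ fr hτ ⟨tJ, ts, tOk, tS, e, e'⟩
    have P₄ := (fr.regs rP rfl).trans P₃
    have Q₄ := (fr.regs rQ rfl).trans Q₃
    have F₄ := (fr.regs rF rfl).trans F₃
    have M₄ := (fr.regs rBlocks rfl).trans M₃
    have K₄ := (fr.regs rChecks rfl).trans K₃
    have R₄ := (fr.regs rPoint rfl).trans R₃
    refine ⟨by simp [tJ, M₄]; omega, ?_⟩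
    refine WP.mono_frame (readBlock_spec (x := AdjoinRoot.root (justesenPoly d)) (d := d)
      ⟨le_rfl, hd1, digitPoly_cast_eq_zero _ _ _, P₄, Q₄, by rw [F₄]; exact digitPoly_root _ _⟩
      (fun a ha b hb h => digitSum_root_inj (digitPoly_monic (p := 2) d (fieldNumber d))
        (by rwa [digitPoly_natDegree]) (by rwa [digitPoly_natDegree])
        (by rwa [digitPoly_natDegree])) ts hL (by omega) tS tOk (by omega)) ?_
    rintro ρ fr' hρ ⟨us, uJ, uOk, ue, uS, ue'⟩
    refine ⟨by omega, by rw [us]; congr 1, uOk, uS, ?_, ?_⟩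
    · rw [ue, e, tJ, Nat.forall_lt_succ_right]
    · rw [ue', e', K₄, R₄, tJ, Finset.sum_range_succ]
  · rintro τ fr hτ ⟨tJ, ts, tOk, tS, e, e'⟩
    have M₄ := (fr.regs rBlocks rfl).trans M₃
    refine ⟨by simp [tJ, M₄], ?_⟩
    refine WP.mono_frame decideSum_spec ?_
    intro ρ _ _ h
    rw [h, e, ← e', and_comm]
    exact and_congr_right fun _ =>
      ⟨fun h => by rw [h, digitSum_zero], digitPoly_root_eq_zero d _ tS⟩

/-! ## Error detectors and parity checks -/

section Detector

theorem distToCode_eq_zero_iff {F : Type*} {n : ℕ} {y : Fin n → F} {C : Set (Fin n → F)}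
    (hC : C.Nonempty) : distToCode y C = 0 ↔ y ∈ C := by
  classical
  unfold distToCode
  rw [Nat.sInf_eq_zero]
  simp [hC.ne_empty, hammingDist_eq_zero]

theorem acceptProb_eq {k s ℓ : ℕ} {P : StreamProg (k + 1)} {params l : List ℕ}
    {G : (Fin ℓ → Bool) → Prop}
    (h : ∀ ω, ∃ τ, StreamRun s P (StreamState.init (k + 1) params l (List.ofFn ω)) τ ∧
      (τ.regs 0 = 1 ↔ G ω)) :
    P.acceptProb s params l ℓ = ({ω | G ω}.ncard : ℝ) / 2 ^ ℓ := by
  have : {ω : Fin ℓ → Bool | P.Accepts s params l (List.ofFn ω)} = {ω | G ω} := by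
    ext ω
    obtain ⟨τ, hr, hτ⟩ := h ω
    constructor
    · rintro ⟨τ', hr', h1⟩
      rw [hr.unique hr'] at hτ
      exact hτ.1 h1
    · exact fun hG => ⟨τ, hr, hτ.2 hG⟩
  rw [StreamProg.acceptProb, this]

/-- Distance `0` means membership and distance at least `(1 / n) * n = 1` means non-membership. What
remains is to count the coin sequences in the event `G`, without reference to machines. -/
theorem isErrorDetector_of_forall_run {F : Type*} {n k s : ℕ} {P : StreamProg (k + 1)}
    {params : List ℕ} {enc : F → ℕ} {C : Set (Fin n → F)} (hn : 1 ≤ n) (hC : C.Nonempty)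
    (ℓ : ℕ) (G : (Fin n → F) → (Fin ℓ → Bool) → Prop)
    (hrun : ∀ y ω, ∃ τ, StreamRun s P (StreamState.init (k + 1) params
      (List.ofFn fun j => enc (y j)) (List.ofFn ω)) τ ∧ (τ.regs 0 = 1 ↔ G y ω))
    (hin : ∀ y ∈ C, ∀ ω, G y ω) (hout : ∀ y ∉ C, 2 * {ω | G y ω}.ncard ≤ 2 ^ ℓ) :
    IsErrorDetector P params enc C 1 s 1 (1 / 2) := by
  have hpass : ∀ y : Fin n → F, passes enc 1 y = List.ofFn fun j => enc (y j) := by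
    simp [passes]
  refine ⟨ℓ, fun y => ⟨fun ω => ?_, fun h => ?_, fun h => ?_⟩⟩
  · rw [hpass]
    obtain ⟨τ, hr, -⟩ := hrun y ω
    exact ⟨τ, hr⟩
  · have hy : y ∈ C := by
      rw [← distToCode_eq_zero_iff hC]
      simpa using h
    rw [hpass, acceptProb_eq (hrun y)]
    simp [hin y hy]
  · have hy : y ∉ C := by
      intro hy
      rw [(distToCode_eq_zero_iff hC).2 hy] at h
      have : (0 : ℝ) < n := by exact_mod_cast hn
      simp [this.ne'] at h
      linarith
    rw [hpass, acceptProb_eq (hrun y), div_le_div_iff₀ (by positivity) (by norm_num)]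
    have := hout y hy
    rw [one_mul, mul_comm]
    exact_mod_cast this

theorem init_fits {k B : ℕ} {params l : List ℕ} {c : List Bool} (h : ∀ a ∈ params, a < 2 ^ B) :
    (StreamState.init k params l c).Fits B := by
  intro i
  simp only [StreamState.init]
  by_cases hi : (i : ℕ) < params.length
  · simpa [hi] using h _ (List.getElem_mem hi)
  · simp [not_lt.1 hi]

theorem coinNumber_ofFn_injective (ℓ : ℕ) :
    Function.Injective fun ω : Fin ℓ → Bool => coinNumber (List.ofFn ω) := by
  intro ω ω' h
  have h' := Nat.ofDigits_inj_of_len_eq (b := 2) (by simp) (by simp) (by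
      intro a ha
      obtain ⟨b, -, rfl⟩ := List.mem_map.1 ha
      exact Bool.toNat_lt b) (by
      intro a ha
      obtain ⟨b, -, rfl⟩ := List.mem_map.1 ha
      exact Bool.toNat_lt b) h
  refine List.ofFn_injective (List.map_injective_iff.2 (fun a b hab => ?_) h')
  cases a <;> cases b <;> simp_all

end Detector

/-! ### Power-sum checks over a domain -/

section ParityChecks

open Polynomial

variable {A : Type*} [CommRing A] [IsDomain A] {ι : Type*}

/-- Power sums with at most `m` nonzero coefficients are determined by the first `m` of them. -/
theorem lt_card_of_sum_mul_pow_eq_zero [DecidableEq A] (s : Finset ι) {α y : ι → A} {m : ℕ}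
    (hα : Set.InjOn α s) (h : ∀ i < m, ∑ j ∈ s, y j * α j ^ i = 0) {j₀ : ι} (hj₀ : j₀ ∈ s)
    (hy : y j₀ ≠ 0) : m < (s.filter fun j => y j ≠ 0).card := by
  classical
  by_contra! hcard
  set T := s.filter fun j => y j ≠ 0
  have hjT : j₀ ∈ T := Finset.mem_filter.2 ⟨hj₀, hy⟩
  -- `P` vanishes at all support points except `α j₀`. For a support of size at most `m` its degree
  -- is below `m`, so the checks would force `y j₀ * P (α j₀) = 0`.
  set P : A[X] := ∏ j ∈ T.erase j₀, (X - C (α j))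
  have hdeg : P.natDegree < m := by
    rw [natDegree_prod_of_monic _ _ fun j _ => monic_X_sub_C _]
    simp only [natDegree_X_sub_C, Finset.sum_const, smul_eq_mul, mul_one,
      Finset.card_erase_of_mem hjT]
    have := Finset.card_pos.2 ⟨_, hjT⟩
    omega
  have hsum : ∑ j ∈ s, y j * P.eval (α j) = 0 := by
    simp only [eval_eq_sum_range' hdeg, Finset.mul_sum]
    rw [Finset.sum_comm]
    refine Finset.sum_eq_zero fun i hi => ?_
    have := h i (Finset.mem_range.1 hi)
    calc _ = P.coeff i * ∑ j ∈ s, y j * α j ^ i := by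
          rw [Finset.mul_sum]; exact Finset.sum_congr rfl fun _ _ => by ring
      _ = 0 := by rw [this, mul_zero]
  rw [Finset.sum_eq_single_of_mem j₀ hj₀] at hsum
  · refine (mul_ne_zero hy ?_) hsum
    rw [eval_prod, Finset.prod_ne_zero_iff]
    intro j hj
    rw [Finset.mem_erase] at hj
    rw [eval_sub, eval_X, eval_C, sub_ne_zero]
    exact fun e => hj.1 (hα (Finset.filter_subset _ _ hj.2) hj₀ e.symm)
  · intro j hj hne
    by_cases hyj : y j = 0
    · rw [hyj, zero_mul]
    · rw [eval_prod, Finset.prod_eq_zero (i := j), mul_zero]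
      · exact Finset.mem_erase.2 ⟨hne, Finset.mem_filter.2 ⟨hj, hyj⟩⟩
      · simp

/-- A random point detects a violated parity check. -/
theorem ncard_random_check_le {Ω : Type*} {s : Finset ι} {α y : ι → A} {m : ℕ} {g : Ω → A}
    (hg : Function.Injective g) (h : ∃ i < m, ∑ j ∈ s, y j * α j ^ i ≠ 0) :
    {ω | ∑ j ∈ s, y j * ∑ i ∈ Finset.range m, (g ω * α j) ^ i = 0}.ncard ≤ m := by
  classical
  -- The syndromes are the coefficients of `P`, and one of them is nonzero.
  set P : A[X] := ∑ i ∈ Finset.range m, C (∑ j ∈ s, y j * α j ^ i) * X ^ i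
  have hcoeff : ∀ i < m, P.coeff i = ∑ j ∈ s, y j * α j ^ i := by
    intro i hi
    simp only [P, finsetSum_coeff, coeff_C_mul, coeff_X_pow]
    simp [hi]
  have hP : P ≠ 0 := by
    obtain ⟨i, hi, hne⟩ := h
    intro h0
    rw [← hcoeff i hi, h0] at hne
    simp at hne
  have hdeg : P.natDegree ≤ m := by
    refine natDegree_sum_le_of_forall_le _ _ fun i hi => ?_
    exact (natDegree_C_mul_X_pow_le _ _).trans (Finset.mem_range.1 hi).le
  have heval : ∀ r, P.eval r = ∑ j ∈ s, y j * ∑ i ∈ Finset.range m, (r * α j) ^ i := by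
    intro r
    simp only [P, eval_finsetSum, eval_mul, eval_C, eval_pow, eval_X, Finset.mul_sum,
      Finset.sum_mul]
    rw [Finset.sum_comm]
    exact Finset.sum_congr rfl fun _ _ => Finset.sum_congr rfl fun _ _ => by ring
  calc _ ≤ (P.roots.toFinset : Set A).ncard := by
        refine Set.ncard_le_ncard_of_injOn g (fun ω hω => ?_) hg.injOn (Finset.finite_toSet _)
        simp only [Finset.mem_coe, Multiset.mem_toFinset, mem_roots hP, IsRoot.def, heval]
        exact hω
    _ ≤ m := by
        rw [Set.ncard_coe_finset]
        exact (Multiset.toFinset_card_le _).trans ((card_roots' P).trans hdeg)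

end ParityChecks

/-! ## Reed-Solomon codes -/

section ReedSolomon

variable {A : Type*}

/-- The code with the parity checks `∑ⱼ yⱼ (α j)^i = 0` for `i < m`. -/
def powerCheckCode [CommRing A] (n m : ℕ) (α : ℕ → A) : Submodule A (Fin n → A) :=
  LinearMap.ker (LinearMap.pi fun i : Fin m =>
    ∑ j : Fin n, (α j ^ (i : ℕ)) • (LinearMap.proj j : (Fin n → A) →ₗ[A] A))

theorem mem_powerCheckCode [CommRing A] {n m : ℕ} {α : ℕ → A} {y : Fin n → A} :
    y ∈ powerCheckCode n m α ↔ ∀ i < m, ∑ j : Fin n, y j * α j ^ i = 0 := by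
  simp only [powerCheckCode, LinearMap.mem_ker, funext_iff, LinearMap.pi_apply,
    LinearMap.sum_apply, LinearMap.smul_apply, LinearMap.proj_apply, smul_eq_mul, Pi.zero_apply,
    mul_comm (α _ ^ _)]
  exact ⟨fun h i hi => h ⟨i, hi⟩, fun h i => h i i.2⟩

/-- The `⌊n/4⌋` equations cost at most that much dimension, and the difference of two distinct
codewords has more than `⌊n/4⌋` nonzero entries. -/
theorem powerCheckCode_hasRateDist [Field A] {n : ℕ} {α : ℕ → A}
    (hα : ∀ i < n, ∀ j < n, α i = α j → i = j) :
    HasRateDist (1 / 4) (1 / 4) (powerCheckCode n (n / 4) α) := by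
  classical
  have h4 : ((n / 4 : ℕ) : ℝ) ≤ n / 4 := Nat.cast_div_le
  constructor
  · have h := LinearMap.finrank_range_add_finrank_ker (LinearMap.pi fun i : Fin (n / 4) =>
      ∑ j : Fin n, (α j ^ (i : ℕ)) • (LinearMap.proj j : (Fin n → A) →ₗ[A] A))
    have h' := Submodule.finrank_le (LinearMap.range (LinearMap.pi fun i : Fin (n / 4) =>
      ∑ j : Fin n, (α j ^ (i : ℕ)) • (LinearMap.proj j : (Fin n → A) →ₗ[A] A)))
    simp only [Module.finrank_fintype_fun_eq_card, Fintype.card_fin] at h h'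
    have : n ≤ n / 4 + Module.finrank A (powerCheckCode n (n / 4) α) := by
      rw [powerCheckCode]
      omega
    have : (n : ℝ) ≤ (n / 4 : ℕ) + (Module.finrank A (powerCheckCode n (n / 4) α) : ℝ) := by
      exact_mod_cast this
    linarith [(Nat.cast_nonneg n : (0 : ℝ) ≤ n)]
  · intro y hy z hz hne
    obtain ⟨j₀, hj₀⟩ := Function.ne_iff.1 hne
    have h := mem_powerCheckCode.1 (sub_mem hy hz)
    have hlt := lt_card_of_sum_mul_pow_eq_zero Finset.univ (α := fun j : Fin n => α j)
      (y := y - z) (fun i _ j _ e => Fin.ext (hα i i.2 j j.2 e)) h (Finset.mem_univ j₀)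
      (sub_ne_zero.2 hj₀)
    have hd : (Finset.univ.filter fun j => (y - z) j ≠ 0).card = hammingDist y z := by
      unfold hammingDist
      congr 1
      ext j
      simp [sub_ne_zero]
    rw [hd] at hlt
    have h5 : n ≤ 4 * hammingDist y z := by omega
    have h6 : (n : ℝ) ≤ 4 * hammingDist y z := by exact_mod_cast h5
    have h7 : 1 / 4 * (n : ℝ) ≤ hammingDist y z := by linarith
    convert h7

/-- The Reed-Solomon code of length `n` over `𝔽_p[X]/(f)`. -/
noncomputable def reedSolomonCode (n p : ℕ) (f : Polynomial (ZMod p)) :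
    Submodule (AdjoinRoot f) (Fin n → AdjoinRoot f) :=
  powerCheckCode n (n / 4) (digitSum (AdjoinRoot.root f) p f.natDegree)

theorem reedSolomonCode_hasRateDist {n p : ℕ} (hp : p.Prime) {f : Polynomial (ZMod p)}
    (hf : f.Monic) (hi : Irreducible f) (hn : n ≤ p ^ f.natDegree) :
    HasRateDist (1 / 4) (1 / 4) (reedSolomonCode n p f) := by
  have : Fact p.Prime := ⟨hp⟩
  have : Fact (Irreducible f) := ⟨hi⟩
  exact powerCheckCode_hasRateDist (A := AdjoinRoot f) fun i hi j hj h =>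
    digitSum_root_inj hf (hi.trans_le hn) (hj.trans_le hn) h

theorem le_two_pow_of_le_mul_pow {n q c : ℕ} (hq : q ≤ c * n ^ c) :
    q ≤ 2 ^ (2 * c * (Nat.log 2 n + 1)) := by
  have hn : n ≤ 2 ^ (Nat.log 2 n + 1) := (Nat.lt_pow_succ_log_self (by simp) n).le
  calc q ≤ 2 ^ c * (2 ^ (Nat.log 2 n + 1)) ^ c :=
        hq.trans (Nat.mul_le_mul Nat.lt_two_pow_self.le (Nat.pow_le_pow_left hn c))
    _ = 2 ^ (c + (Nat.log 2 n + 1) * c) := by rw [← pow_mul, ← pow_add]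
    _ ≤ 2 ^ (2 * c * (Nat.log 2 n + 1)) := Nat.pow_le_pow_right (by simp) (by nlinarith)

theorem reedSolomonDetector_isErrorDetector {n p c : ℕ} (hn : 1 ≤ n) (hp : p.Prime)
    {f : Polynomial (ZMod p)} (hf : f.Monic) (hi : Irreducible f) (hnq : n ≤ p ^ f.natDegree)
    (hq : p ^ f.natDegree ≤ c * n ^ c) :
    IsErrorDetector (k := 23) reedSolomonDetector [n, p, polyCode f] (fieldCode hf)
      (reedSolomonCode n p f : Set (Fin n → AdjoinRoot f)) 1
      (24 * (4 * c + 1) * (Nat.log 2 n + 1)) 1 (1 / 2) := by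
  have : Fact p.Prime := ⟨hp⟩
  have : Fact (Irreducible f) := ⟨hi⟩
  have hd : 1 ≤ f.natDegree := hi.natDegree_pos
  have hF1 := polyCode_lead hf
  have hF2 := polyCode_lt (Nat.lt_succ_self f.natDegree)
  have hlog : Nat.log p (polyCode f) = f.natDegree := Nat.log_eq_of_pow_le_of_lt_pow hF1 hF2
  have hq0 : 1 ≤ p ^ f.natDegree := Nat.one_le_pow _ _ hp.pos
  have hpq : p ≤ p ^ f.natDegree := Nat.le_self_pow (by omega) p
  set q := p ^ f.natDegree with hqdef
  -- The bound is `q²` rather than `q` because the code of `f` has one digit more than a field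
  -- element: it is below `q p ≤ q²`.
  have hB : q * q < 2 ^ ((4 * c + 1) * (Nat.log 2 n + 1)) := by
    have h := le_two_pow_of_le_mul_pow hq
    calc q * q ≤ 2 ^ (2 * c * (Nat.log 2 n + 1)) * 2 ^ (2 * c * (Nat.log 2 n + 1)) :=
          Nat.mul_le_mul h h
      _ = 2 ^ (4 * c * (Nat.log 2 n + 1)) := by rw [← pow_add]; congr 1; ring
      _ < _ := Nat.pow_lt_pow_right (by simp) (by nlinarith)
  have hqq : q ≤ q * q := Nat.le_mul_self q
  have hFq : polyCode f < q * q := hF2.trans_le (by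
    rw [pow_succ, ← hqdef]
    exact Nat.mul_le_mul_left _ hpq)
  rw [mul_assoc]
  refine isErrorDetector_of_forall_run hn ⟨0, zero_mem _⟩ (Nat.log 2 q)
    (fun y ω => ∑ j : Fin n, y j * ∑ i ∈ Finset.range (n / 4),
      (digitSum (AdjoinRoot.root f) p f.natDegree (coinNumber (List.ofFn ω))
        * digitSum (AdjoinRoot.root f) p f.natDegree j) ^ i = 0) ?_ ?_ ?_
  · intro y ω
    have hget : ∀ t, (List.ofFn fun j => fieldCode hf (y j)).getD t 0
        = if h : t < n then fieldCode hf (y ⟨t, h⟩) else 0 := by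
      intro t
      split_ifs with h <;> simp [h]
    obtain ⟨τ, hr, -, hτ⟩ := reedSolomonDetector_spec (A := AdjoinRoot f)
      (x := AdjoinRoot.root f) (n := n) (L := List.ofFn fun j => fieldCode hf (y j))
      (σ := StreamState.init 24 [n, p, polyCode f] (List.ofFn fun j => fieldCode hf (y j))
        (List.ofFn ω)) (B := (4 * c + 1) * (Nat.log 2 n + 1)) hp.two_le hd
      (by rw [← map_natCast (algebraMap (ZMod p) (AdjoinRoot f))]; simp)
      (digitSum_root_polyCode hf) hlog (fun a => digitSum_root_eq_zero hf)
      (fun t => by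
        rw [hget]
        split_ifs
        · exact (digitSum_fieldCode hf hd _).1
        · omega) rfl rfl rfl rfl (by simp [StreamState.init, q]) (init_fits (by
        simp only [List.mem_cons, List.not_mem_nil, or_false, forall_eq_or_imp, forall_eq]
        omega))
    refine ⟨τ, hr, hτ.trans ?_⟩
    rw [Finset.sum_range]
    simp only [hget, Fin.is_lt, dif_pos, Fin.eta, (digitSum_fieldCode hf hd _).2]
    rfl
  · intro y hy ω
    have h := mem_powerCheckCode.1 hy
    -- Exchanging the sums turns the tested value into a combination of the syndromes, all of which
    -- vanish.
    simp only [Finset.mul_sum, mul_pow]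
    rw [Finset.sum_comm]
    refine Finset.sum_eq_zero fun i hi => ?_
    have := h i (Finset.mem_range.1 hi)
    simp only [mul_left_comm (y _), ← Finset.mul_sum, this, mul_zero]
  · intro y hy
    have hy' : ¬ ∀ i < n / 4, ∑ j : Fin n,
        y j * digitSum (AdjoinRoot.root f) p f.natDegree j ^ i = 0 :=
      fun h => hy (mem_powerCheckCode.2 h)
    push Not at hy'
    have hlt : ∀ ω : Fin (Nat.log 2 q) → Bool, coinNumber (List.ofFn ω) < q := fun ω =>
      (coinNumber_lt _).trans_le (by simpa using Nat.pow_log_le_self 2 (by omega))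
    have h := ncard_random_check_le (A := AdjoinRoot f)
      (g := fun ω : Fin (Nat.log 2 q) → Bool =>
        digitSum (AdjoinRoot.root f) p f.natDegree (coinNumber (List.ofFn ω)))
      (fun ω ω' h => coinNumber_ofFn_injective _ (digitSum_root_inj hf (hlt ω) (hlt ω') h)) hy'
    -- There are more than `q / 2` coin sequences and at most `n / 4 ≤ q / 4` of them accept.
    have h2 : q < 2 ^ (Nat.log 2 q + 1) := Nat.lt_pow_succ_log_self (by simp) q
    rw [pow_succ] at h2
    omega

end ReedSolomon

/-! ## Justesen codes -/

/-! ### Total weight of distinct binary words -/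

section Weights

/-- The sum factors over the coordinates, each contributing `1 + 1/8`. As in a Chernoff bound, it
limits the number of words of low weight. -/
theorem sum_pow_hammingNorm (L : ℕ) :
    ∑ v : Fin L → ZMod 2, (1 / 8 : ℝ) ^ hammingNorm v = (9 / 8) ^ L := by
  have h : ∀ v : Fin L → ZMod 2, (1 / 8 : ℝ) ^ hammingNorm v
      = ∏ i, if v i ≠ 0 then (1 / 8 : ℝ) else 1 := by
    intro v
    rw [Finset.prod_ite, Finset.prod_const, Finset.prod_const_one, mul_one]
    rfl
  have h2 : ∑ a : ZMod 2, (if a ≠ 0 then (1 / 8 : ℝ) else 1) = 9 / 8 := by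
    rw [show (Finset.univ : Finset (ZMod 2)) = {0, 1} from by decide, Finset.sum_pair (by decide)]
    norm_num
  simp only [h]
  rw [← Fintype.piFinset_univ, ← Finset.prod_univ_sum (fun _ : Fin L => Finset.univ)
    (fun _ a => if a ≠ (0 : ZMod 2) then (1 / 8 : ℝ) else 1)]
  simp only [h2]
  rw [Finset.prod_const, Finset.card_univ, Fintype.card_fin]

/-- Distinct binary words have a large total weight. -/
theorem le_sum_hammingNorm {ι : Type*} {L : ℕ} (s : Finset ι) {v : ι → Fin L → ZMod 2}
    (hv : Set.InjOn v s) (w : ℕ) :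
    w * ((s.card : ℝ) - 8 ^ w * (9 / 8) ^ L) ≤ ∑ j ∈ s, (hammingNorm (v j) : ℝ) := by
  classical
  have h1 : ∑ j ∈ s, (1 / 8 : ℝ) ^ hammingNorm (v j) ≤ (9 / 8) ^ L := by
    rw [← sum_pow_hammingNorm, ← Finset.sum_image (g := v)
      (f := fun v => (1 / 8 : ℝ) ^ hammingNorm v) hv]
    exact Finset.sum_le_sum_of_subset_of_nonneg (Finset.subset_univ _) fun _ _ _ => by positivity
  -- For `t ≥ w` the subtracted term only helps; for `t < w` the left side is at most zero.
  have h2 : ∀ t : ℕ, (w : ℝ) * (1 - 8 ^ w * (1 / 8) ^ t) ≤ t := by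
    intro t
    have hw : (0 : ℝ) ≤ w := Nat.cast_nonneg _
    rcases le_or_gt w t with h | h
    · have : (w : ℝ) ≤ t := by exact_mod_cast h
      have h3 : (0 : ℝ) ≤ 8 ^ w * (1 / 8) ^ t := by positivity
      nlinarith
    · have h3 : (1 : ℝ) ≤ 8 ^ w * (1 / 8) ^ t := by
        rw [one_div_pow, mul_one_div, one_le_div (by positivity)]
        exact pow_le_pow_right₀ (by norm_num) h.le
      have ht : (0 : ℝ) ≤ t := Nat.cast_nonneg _
      nlinarith
  calc w * ((s.card : ℝ) - 8 ^ w * (9 / 8) ^ L)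
      ≤ w * ((s.card : ℝ) - 8 ^ w * ∑ j ∈ s, (1 / 8 : ℝ) ^ hammingNorm (v j)) := by gcongr
    _ = ∑ j ∈ s, (w : ℝ) * (1 - 8 ^ w * (1 / 8) ^ hammingNorm (v j)) := by
        rw [← Finset.mul_sum, Finset.sum_sub_distrib, ← Finset.mul_sum]
        simp
    _ ≤ _ := Finset.sum_le_sum fun j _ => h2 _

/-- The letter number `i` of a word that is continued by zeros. -/
def letter {n : ℕ} (y : Fin n → ZMod 2) (i : ℕ) : ZMod 2 := if h : i < n then y ⟨i, h⟩ else 0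

theorem sum_range_mul {M : Type*} [AddCommMonoid M] (g : ℕ → M) (L N : ℕ) :
    ∑ i ∈ Finset.range (L * N), g i
      = ∑ j ∈ Finset.range N, ∑ t ∈ Finset.range L, g (L * j + t) := by
  induction N with
  | zero => simp
  | succ N ih => rw [Nat.mul_succ, Finset.sum_range_add, ih, Finset.sum_range_succ]

theorem hammingNorm_eq_sum_blocks {n L N : ℕ} (h : n ≤ L * N) (y : Fin n → ZMod 2) :
    hammingNorm y = ∑ j ∈ Finset.range N, hammingNorm fun t : Fin L => letter y (L * j + t) := by
  have h0 : ∀ (k : ℕ) (v : Fin k → ZMod 2), hammingNorm v = ∑ i, if v i ≠ 0 then 1 else 0 :=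
    fun k v => by rw [hammingNorm, Finset.card_filter]
  have h1 : hammingNorm y = ∑ i ∈ Finset.range (L * N), if letter y i ≠ 0 then 1 else 0 := by
    rw [← Finset.sum_subset (Finset.range_subset_range.2 h), Finset.sum_range, h0]
    · exact Finset.sum_congr rfl fun i _ => by simp [letter]
    · intro i _ hi
      simp only [Finset.mem_range] at hi
      simp [letter, hi]
  rw [h1, sum_range_mul]
  refine Finset.sum_congr rfl fun j _ => ?_
  rw [h0, Finset.sum_range]

end Weights

/-! ### Dimension and distance of the block codes -/

section BlockCode

variable {A : Type*} [Field A] [Algebra (ZMod 2) A]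

/-- The block of `d` letters from position `k` on, as an element of `A`. -/
def blockMap (n d : ℕ) (x : A) (k : ℕ) : (Fin n → ZMod 2) →ₗ[ZMod 2] A where
  toFun y := blockSum x d (fun i => algebraMap (ZMod 2) A (letter y i)) k
  map_add' y z := by
    rw [blockSum, blockSum, blockSum, ← Finset.sum_add_distrib]
    refine Finset.sum_congr rfl fun t _ => ?_
    rw [← add_mul, ← map_add]
    congr 2
    unfold letter
    split_ifs <;> simp
  map_smul' c y := by
    rw [blockSum, blockSum, RingHom.id_apply, Finset.smul_sum]
    refine Finset.sum_congr rfl fun t _ => ?_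
    rw [Algebra.smul_def (A := A), ← mul_assoc, ← map_mul]
    congr 2
    unfold letter
    split_ifs <;> simp

theorem blockMap_apply (n d : ℕ) (x : A) (k : ℕ) (y : Fin n → ZMod 2) : blockMap n d x k y
    = ∑ t ∈ Finset.range d, algebraMap (ZMod 2) A (letter y (k + t)) * x ^ t := rfl

/-- The words of `N` blocks `(yⱼ, yⱼ αⱼ)` whose first halves satisfy `∑ⱼ yⱼ αⱼ^i = 0` for
`i < m`, shortened to length `n`. -/
def blockCode (n d N m : ℕ) (x : A) (α : ℕ → A) : Submodule (ZMod 2) (Fin n → ZMod 2) :=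
  LinearMap.ker <| LinearMap.prod
    (LinearMap.pi fun j : Fin N => blockMap n d x (2 * d * j + d)
      - LinearMap.mulRight (ZMod 2) (α j) ∘ₗ blockMap n d x (2 * d * j))
    (LinearMap.pi fun i : Fin m => ∑ j : Fin N,
      LinearMap.mulRight (ZMod 2) (α j ^ (i : ℕ)) ∘ₗ blockMap n d x (2 * d * j))

variable {n d N m : ℕ} {x : A} {α : ℕ → A}

theorem mem_blockCode {y : Fin n → ZMod 2} : y ∈ blockCode n d N m x α ↔
    (∀ j < N, blockMap n d x (2 * d * j + d) y = blockMap n d x (2 * d * j) y * α j) ∧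
      ∀ i < m, ∑ j ∈ Finset.range N, blockMap n d x (2 * d * j) y * α j ^ i = 0 := by
  simp only [blockCode, LinearMap.mem_ker, LinearMap.prod_apply, Function.prod, Prod.mk_eq_zero,
    funext_iff, LinearMap.pi_apply, LinearMap.sub_apply, LinearMap.comp_apply,
    LinearMap.mulRight_apply, LinearMap.sum_apply, Pi.zero_apply, sub_eq_zero, Finset.sum_range]
  exact and_congr ⟨fun h i hi => h ⟨i, hi⟩, fun h i => h i i.2⟩
    ⟨fun h i hi => h ⟨i, hi⟩, fun h i => h i i.2⟩

/-- Each of the `N + m` equations takes values in `A`, so it counts as `d` equations over `𝔽₂`. -/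
theorem le_finrank_blockCode [FiniteDimensional (ZMod 2) A]
    (hA : Module.finrank (ZMod 2) A = d) :
    n ≤ N * d + m * d + Module.finrank (ZMod 2) (blockCode n d N m x α) := by
  have h := LinearMap.finrank_range_add_finrank_ker (LinearMap.prod
    (LinearMap.pi fun j : Fin N => blockMap n d x (2 * d * j + d)
      - LinearMap.mulRight (ZMod 2) (α j) ∘ₗ blockMap n d x (2 * d * j))
    (LinearMap.pi fun i : Fin m => ∑ j : Fin N,
      LinearMap.mulRight (ZMod 2) (α j ^ (i : ℕ)) ∘ₗ blockMap n d x (2 * d * j)))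
  have h' := Submodule.finrank_le (LinearMap.range (LinearMap.prod
    (LinearMap.pi fun j : Fin N => blockMap n d x (2 * d * j + d)
      - LinearMap.mulRight (ZMod 2) (α j) ∘ₗ blockMap n d x (2 * d * j))
    (LinearMap.pi fun i : Fin m => ∑ j : Fin N,
      LinearMap.mulRight (ZMod 2) (α j ^ (i : ℕ)) ∘ₗ blockMap n d x (2 * d * j))))
  simp only [Module.finrank_prod, Module.finrank_pi_fintype, hA, Finset.sum_const,
    Finset.card_univ, Fintype.card_fin, smul_eq_mul, Module.finrank_self, mul_one] at h h'
  rw [blockCode]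
  omega

/-- If all first halves vanished, so would the second halves and hence `y`; thus the checks make
more than `m` first halves nonzero. Such blocks are distinct, since `yⱼ ≠ 0` and `yⱼ αⱼ` determine
`αⱼ`, and `le_sum_hammingNorm` applies with word length `2 * d`. -/
theorem le_hammingNorm_of_mem_blockCode (hn : n ≤ 2 * d * N)
    (hx : ∀ c : ℕ → ZMod 2, ∑ t ∈ Finset.range d, algebraMap (ZMod 2) A (c t) * x ^ t = 0 →
      ∀ t < d, c t = 0)
    (hα : Set.InjOn α (Finset.range N)) {y : Fin n → ZMod 2} (hy : y ∈ blockCode n d N m x α)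
    (hy0 : y ≠ 0) (w : ℕ) :
    w * ((m : ℝ) + 1 - 8 ^ w * (9 / 8) ^ (2 * d)) ≤ hammingNorm y := by
  classical
  obtain ⟨h1, h2⟩ := mem_blockCode.1 hy
  have hex : ∃ j ∈ Finset.range N, blockMap n d x (2 * d * j) y ≠ 0 := by
    by_contra! h0
    refine hy0 (hammingNorm_eq_zero.1 ?_)
    rw [hammingNorm_eq_sum_blocks hn]
    refine Finset.sum_eq_zero fun j hj => ?_
    rw [hammingNorm_eq_zero]
    have hj1 := h0 j hj
    have hj2 := h1 j (Finset.mem_range.1 hj)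
    rw [hj1, zero_mul] at hj2
    funext t
    rcases lt_or_ge (t : ℕ) d with ht | ht
    · exact hx (fun t => letter y (2 * d * j + t)) hj1 t ht
    · have := hx (fun t => letter y (2 * d * j + d + t)) hj2 (t - d) (by omega)
      rwa [show 2 * d * j + d + (t - d) = 2 * d * j + t by omega] at this
  obtain ⟨j₀, hj₀, hne⟩ := hex
  have hcard := lt_card_of_sum_mul_pow_eq_zero _ hα h2 hj₀ hne
  set T := (Finset.range N).filter fun j => blockMap n d x (2 * d * j) y ≠ 0
  have hinj : Set.InjOn (fun (j : ℕ) (t : Fin (2 * d)) => letter y (2 * d * j + t)) T := by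
    intro i hi j hj e
    obtain ⟨hi, hi0⟩ := Finset.mem_filter.1 hi
    obtain ⟨hj, hj0⟩ := Finset.mem_filter.1 hj
    have hl : ∀ t < 2 * d, letter y (2 * d * i + t) = letter y (2 * d * j + t) :=
      fun t ht => congrFun e ⟨t, ht⟩
    have e1 : blockMap n d x (2 * d * i) y = blockMap n d x (2 * d * j) y := by
      rw [blockMap_apply, blockMap_apply]
      refine Finset.sum_congr rfl fun t ht => ?_
      have := Finset.mem_range.1 ht
      rw [hl t (by omega)]
    have e2 : blockMap n d x (2 * d * i + d) y = blockMap n d x (2 * d * j + d) y := by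
      rw [blockMap_apply, blockMap_apply]
      refine Finset.sum_congr rfl fun t ht => ?_
      have := Finset.mem_range.1 ht
      rw [add_assoc, add_assoc, hl (d + t) (by omega)]
    rw [h1 i (Finset.mem_range.1 hi), h1 j (Finset.mem_range.1 hj), e1] at e2
    exact hα hi hj (mul_left_cancel₀ hj0 e2)
  have hcard' : (m : ℝ) + 1 ≤ T.card := by exact_mod_cast hcard
  calc w * ((m : ℝ) + 1 - 8 ^ w * (9 / 8) ^ (2 * d))
      ≤ w * ((T.card : ℝ) - 8 ^ w * (9 / 8) ^ (2 * d)) := by gcongr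
    _ ≤ _ := le_sum_hammingNorm T hinj w
    _ ≤ hammingNorm y := by
        rw [hammingNorm_eq_sum_blocks hn]
        push_cast
        exact Finset.sum_le_sum_of_subset_of_nonneg (Finset.filter_subset _ _)
          fun _ _ _ => Nat.cast_nonneg _

end BlockCode

/-! ### Parameters of the Justesen code and its detector -/

section Justesen

theorem eight_mul_le_two_pow {d : ℕ} (hd : 40 ≤ d) : 8 * d ≤ 2 ^ d := by
  induction d, hd using Nat.le_induction with
  | base => norm_num
  | succ d hd ih => rw [pow_succ]; omega

theorem mul_le_four_pow {w : ℕ} (hw : 5 ≤ w) : 128 * (w + 1) ≤ 4 ^ w := by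
  induction w, hw using Nat.le_induction with
  | base => norm_num
  | succ w hw ih => rw [pow_succ]; omega

/-- With `w = d / 8`, both `8 ^ w` and essentially `((9 / 8) ^ 16) ^ w` are at most `8 ^ w`. As `2 ^
8 = 8 * 8 * 4`, a factor `4 ^ w` is left over to absorb `16 * d`. -/
theorem low_weight_count_le {d : ℕ} (hd : 40 ≤ d) :
    (8 : ℝ) ^ (d / 8) * (9 / 8) ^ (2 * d) * (16 * d) ≤ 2 ^ d := by
  obtain ⟨w, s, hs, rfl⟩ : ∃ w s, s < 8 ∧ d = 8 * w + s :=
    ⟨d / 8, d % 8, Nat.mod_lt _ (by simp), (Nat.div_add_mod d 8).symm⟩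
  have hw : (8 * w + s) / 8 = w := by omega
  have h4 : (128 * (w + 1) : ℝ) ≤ 4 ^ w := by exact_mod_cast mul_le_four_pow (by omega : 5 ≤ w)
  have hs' : (s : ℝ) ≤ 8 := by exact_mod_cast hs.le
  rw [hw, pow_mul, pow_add, pow_mul, pow_add (2 : ℝ), pow_mul (2 : ℝ)]
  calc (8 : ℝ) ^ w * ((((9 / 8) ^ 2) ^ 8) ^ w * ((9 / 8) ^ 2) ^ s) * (16 * ((8 * w + s : ℕ) : ℝ))
      ≤ 8 ^ w * (8 ^ w * 2 ^ s) * (16 * (8 * (w + 1))) := by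
        gcongr
        · norm_num
        · norm_num
        · push_cast
          linarith
    _ = 8 ^ w * (8 ^ w * 2 ^ s) * (128 * (w + 1)) := by ring
    _ ≤ 8 ^ w * (8 ^ w * 2 ^ s) * 4 ^ w := by gcongr
    _ = (2 ^ 8) ^ w * 2 ^ s := by
        rw [show ((2 : ℝ) ^ 8) = 8 * 8 * 4 by norm_num, mul_pow, mul_pow]
        ring

/-- The Justesen code of length `n`. -/
noncomputable def justesenCode (n : ℕ) : Submodule (ZMod 2) (Fin n → ZMod 2) :=
  if h : n < 2 ^ 40 then ⊤ else
    haveI : Fact (Irreducible (justesenPoly (Nat.log 2 n))) :=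
      ⟨(fieldNumber_spec (Nat.log_pos (by simp) (by omega))).2.2⟩
    blockCode n (Nat.log 2 n) (n / (2 * Nat.log 2 n) + 1) ((n / (2 * Nat.log 2 n) + 1) / 4)
      (AdjoinRoot.root (justesenPoly (Nat.log 2 n)))
      (digitSum (AdjoinRoot.root (justesenPoly (Nat.log 2 n))) 2 (Nat.log 2 n))

theorem justesenPoly_basis (d : ℕ) (c : ℕ → ZMod 2)
    (h : ∑ t ∈ Finset.range d, algebraMap (ZMod 2) (AdjoinRoot (justesenPoly d)) (c t)
      * AdjoinRoot.root (justesenPoly d) ^ t = 0) : ∀ t < d, c t = 0 := by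
  intro t ht
  have hm : (justesenPoly d).Monic := digitPoly_monic _ _
  have hnd : (justesenPoly d).natDegree = d := digitPoly_natDegree _ _
  have hlt := sum_range_mul_pow_lt 2 (c := fun t => (c t).val) (fun t => ZMod.val_lt _) d
  have hA : ((2 : ℕ) : AdjoinRoot (justesenPoly d)) = 0 := digitPoly_cast_eq_zero _ _ _
  have hsum := digitSum_sum (AdjoinRoot.root (justesenPoly d)) hA (c := fun t => (c t).val)
    (fun t => ZMod.val_lt _) d
  have hcast : ∀ t, (((c t).val : ℕ) : AdjoinRoot (justesenPoly d)) = algebraMap (ZMod 2) _ (c t) := by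
    intro t
    rw [← map_natCast (algebraMap (ZMod 2) _), ZMod.natCast_zmod_val]
  simp only [hcast, h] at hsum
  have h0 := digitPoly_root_eq_zero d _ hlt hsum
  have := (Finset.sum_eq_zero_iff.1 h0) t (Finset.mem_range.2 ht)
  simpa using this

theorem justesenPoly_inj (d : ℕ) {N : ℕ} (hN : N ≤ 2 ^ d) :
    Set.InjOn (digitSum (AdjoinRoot.root (justesenPoly d)) 2 d) (Finset.range N) := by
  intro i hi j hj h
  rw [Finset.coe_range, Set.mem_Iio] at hi hj
  exact digitSum_root_inj (digitPoly_monic (p := 2) d (fieldNumber d))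
    (by rw [digitPoly_natDegree]; omega) (by rw [digitPoly_natDegree]; omega)
    (by rwa [digitPoly_natDegree])

/-- Block indices have to be numbers of distinct field elements. -/
theorem blocks_le {n d : ℕ} (hd : 40 ≤ d) (hn : n < 2 ^ (d + 1)) : n / (2 * d) + 1 ≤ 2 ^ d := by
  have h8 := eight_mul_le_two_pow hd
  have : n / (2 * d) ≤ n / 80 := Nat.div_le_div_left (by omega) (by simp)
  rw [pow_succ] at hn
  omega

theorem justesenCode_hasRateDist {n : ℕ} : HasRateDist (1 / 8) (1 / 2 ^ 40) (justesenCode n) := by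
  classical
  have hn0 : (0 : ℝ) ≤ n := Nat.cast_nonneg n
  by_cases hn : n < 2 ^ 40
  · have hC : justesenCode n = ⊤ := by rw [justesenCode, dif_pos hn]
    rw [hC]
    refine ⟨?_, fun y _ z _ hne => ?_⟩
    · rw [finrank_top, Module.finrank_fintype_fun_eq_card, Fintype.card_fin]
      linarith
    · have h1 : (1 : ℝ) ≤ hammingDist y z := by
        exact_mod_cast Nat.one_le_iff_ne_zero.2 (hammingDist_ne_zero.2 hne)
      have h2 : (n : ℝ) ≤ 2 ^ 40 := by exact_mod_cast hn.le
      have h3 : 1 / 2 ^ 40 * (n : ℝ) ≤ hammingDist y z := by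
        rw [one_div, inv_mul_le_iff₀ (by positivity)]
        nlinarith
      convert h3
  · set d := Nat.log 2 n with hd
    have hd40 : 40 ≤ d := (Nat.le_log_iff_pow_le (by simp) (by omega)).2 (by omega)
    have hirr : Fact (Irreducible (justesenPoly d)) := ⟨(fieldNumber_spec (by omega)).2.2⟩
    have hC : justesenCode n = blockCode n d (n / (2 * d) + 1) ((n / (2 * d) + 1) / 4)
        (AdjoinRoot.root (justesenPoly d)) (digitSum (AdjoinRoot.root (justesenPoly d)) 2 d) := by
      simp only [justesenCode, hn, dif_neg, not_false_eq_true]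
      rfl
    rw [hC]
    have hnlo : 2 ^ d ≤ n := Nat.pow_log_le_self 2 (by omega)
    have hnhi : n < 2 ^ (d + 1) := Nat.lt_pow_succ_log_self (by simp) n
    have h8 := eight_mul_le_two_pow hd40
    have hN := blocks_le hd40 hnhi
    have hdiv : 2 * d * (n / (2 * d)) ≤ n := Nat.mul_div_le n (2 * d)
    have hdiv' : n < 2 * d * (n / (2 * d) + 1) := Nat.lt_mul_div_succ n (by omega)
    set N := n / (2 * d) + 1 with hNdef
    have hm4 : 4 * (N / 4) ≤ N := Nat.mul_div_le N 4
    have hm4' : N < 4 * (N / 4 + 1) := Nat.lt_mul_div_succ N (by simp)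
    set m := N / 4
    constructor
    · have hfin : FiniteDimensional (ZMod 2) (AdjoinRoot (justesenPoly d)) :=
        (AdjoinRoot.powerBasis hirr.out.ne_zero).finite
      have hrank : Module.finrank (ZMod 2) (AdjoinRoot (justesenPoly d)) = d := by
        rw [(AdjoinRoot.powerBasis hirr.out.ne_zero).finrank, AdjoinRoot.powerBasis_dim,
          digitPoly_natDegree]
      have h := le_finrank_blockCode (n := n) (N := N) (m := m)
        (x := AdjoinRoot.root (justesenPoly d))
        (α := digitSum (AdjoinRoot.root (justesenPoly d)) 2 d) hrank
      set r := Module.finrank (ZMod 2) (blockCode n d N m (AdjoinRoot.root (justesenPoly d))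
        (digitSum (AdjoinRoot.root (justesenPoly d)) 2 d))
      have e1 : 2 * (N * d) ≤ n + 2 * d := by
        calc 2 * (N * d) = 2 * d * (n / (2 * d)) + 2 * d := by rw [hNdef]; ring
          _ ≤ n + 2 * d := by omega
      have e2 : 4 * (m * d) ≤ N * d := by
        rw [← mul_assoc]
        exact Nat.mul_le_mul_right _ hm4
      -- The inequalities combine to `n ≤ (5/4) (n/2 + d) + r`, and `8 d ≤ 2 ^ d ≤ n`.
      have : n ≤ 8 * r := by omega
      have : (n : ℝ) ≤ 8 * r := by exact_mod_cast this
      linarith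
    · intro y hy z hz hne
      have h := le_hammingNorm_of_mem_blockCode hdiv'.le (justesenPoly_basis d)
        (justesenPoly_inj d hN) (sub_mem hy hz) (sub_ne_zero.2 hne) (d / 8)
      have hlow := low_weight_count_le hd40
      have hdR : (40 : ℝ) ≤ d := by exact_mod_cast hd40
      have r1 : (N : ℝ) ≤ 4 * (m + 1) := by exact_mod_cast hm4'.le
      have r2 : (n : ℝ) ≤ 2 * d * N := by exact_mod_cast hdiv'.le
      have r3 : (2 : ℝ) ^ d ≤ n := by exact_mod_cast hnlo
      have r4 : (d : ℝ) ≤ 16 * (d / 8 : ℕ) := by exact_mod_cast (by omega : d ≤ 16 * (d / 8))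
      -- After multiplication by `16 d` this follows from `2 ^ d ≤ n ≤ 2 d N`. Low-weight blocks
      -- thus account for at most half of the `N / 4` guaranteed nonzero ones.
      have r5 : (8 : ℝ) ^ (d / 8) * (9 / 8) ^ (2 * d) ≤ N / 8 := by
        refine le_of_mul_le_mul_right ?_ (by linarith : (0 : ℝ) < 16 * d)
        nlinarith
      have r6 : (n : ℝ) ≤ 256 * hammingNorm (y - z) := by
        have hN0 : (0 : ℝ) ≤ N := Nat.cast_nonneg _
        calc (n : ℝ) ≤ 2 * d * N := r2
          _ ≤ 2 * (16 * (d / 8 : ℕ)) * N := by gcongr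
          _ = 256 * ((d / 8 : ℕ) * (N / 4 - N / 8)) := by ring
          _ ≤ 256 * ((d / 8 : ℕ) * ((m : ℝ) + 1 - 8 ^ (d / 8) * (9 / 8) ^ (2 * d))) := by
              gcongr
              linarith
          _ ≤ _ := by gcongr
      have h7 : 1 / 2 ^ 40 * (n : ℝ) ≤ hammingDist y z := by
        rw [hammingDist_comm, hammingDist_eq_hammingNorm, neg_add_eq_sub, one_div,
          inv_mul_le_iff₀ (by positivity)]
        refine r6.trans (mul_le_mul_of_nonneg_right ?_ (Nat.cast_nonneg _))
        norm_num
      convert h7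

theorem justesenDetector_isErrorDetector {n : ℕ} (hn1 : 1 ≤ n) :
    IsErrorDetector (k := 23) justesenDetector [n] ZMod.val
      (justesenCode n : Set (Fin n → ZMod 2)) 1 (48 * (Nat.log 2 n + 1)) 1 (1 / 2) := by
  have hs : 48 * (Nat.log 2 n + 1) = 24 * (2 * (Nat.log 2 n + 1)) := by ring
  have hnhi : n < 2 ^ (Nat.log 2 n + 1) := Nat.lt_pow_succ_log_self (by simp) n
  have hfit : n < 2 ^ (2 * (Nat.log 2 n + 1)) :=
    hnhi.trans_le (Nat.pow_le_pow_right (by simp) (by omega))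
  have hinit : ∀ l c, (StreamState.init 24 [n] l c).Fits (2 * (Nat.log 2 n + 1)) :=
    fun l c => init_fits (by simpa using hfit)
  rw [hs]
  by_cases hn : n < 2 ^ 40
  · have hC : justesenCode n = ⊤ := by rw [justesenCode, dif_pos hn]
    -- The code is the whole space here, so accepting everything without any coin is correct.
    refine isErrorDetector_of_forall_run hn1 ⟨0, zero_mem _⟩ 0 (fun _ _ => True) ?_ (by simp)
      (by simp [hC])
    intro y ω
    obtain ⟨τ, hr, -, hτ⟩ := justesenDetector_small (n := n) rfl hn (by omega) (hinit
      (List.ofFn fun j => ZMod.val (y j)) (List.ofFn ω))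
    exact ⟨τ, hr, by simp [hτ]⟩
  · set d := Nat.log 2 n with hd
    have hd40 : 40 ≤ d := (Nat.le_log_iff_pow_le (by simp) (by omega)).2 (by omega)
    have hirr : Fact (Irreducible (justesenPoly d)) := ⟨(fieldNumber_spec (by omega)).2.2⟩
    have hC : justesenCode n = blockCode n d (n / (2 * d) + 1) ((n / (2 * d) + 1) / 4)
        (AdjoinRoot.root (justesenPoly d)) (digitSum (AdjoinRoot.root (justesenPoly d)) 2 d) := by
      simp only [justesenCode, hn, dif_neg, not_false_eq_true]
      rfl
    have hN := blocks_le hd40 hnhi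
    set N := n / (2 * d) + 1 with hNdef
    refine isErrorDetector_of_forall_run hn1 ⟨0, zero_mem _⟩ d
      (fun y ω => (∀ j < N, blockMap n d (AdjoinRoot.root (justesenPoly d)) (2 * d * j + d) y
          = blockMap n d (AdjoinRoot.root (justesenPoly d)) (2 * d * j) y
            * digitSum (AdjoinRoot.root (justesenPoly d)) 2 d j) ∧
        ∑ j ∈ Finset.range N, blockMap n d (AdjoinRoot.root (justesenPoly d)) (2 * d * j) y
          * ∑ i ∈ Finset.range (N / 4),
            (digitSum (AdjoinRoot.root (justesenPoly d)) 2 d (coinNumber (List.ofFn ω))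
              * digitSum (AdjoinRoot.root (justesenPoly d)) 2 d j) ^ i = 0) ?_ ?_ ?_
    · intro y ω
      have hget : ∀ t, (List.ofFn fun j => ZMod.val (y j)).getD t 0 = (letter y t).val := by
        intro t
        unfold letter
        split_ifs with h <;> simp [h]
      -- The largest value is the counter of the zero-divisor test, which reaches `2 ^ d * 2 ^ d`
      -- and so fits into `2 * (d + 1)` bits.
      obtain ⟨τ, hr, -, hτ⟩ := justesenDetector_spec
        (L := List.ofFn fun j => ZMod.val (y j)) (n := n) rfl (not_lt.1 hn) hd
        (B := 2 * (d + 1)) (by rw [← pow_add]; exact Nat.pow_lt_pow_right (by simp) (by omega))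
        rfl (fun t => by rw [hget]; exact ZMod.val_lt _) (by simp [StreamState.init]) _ rfl
        (hinit (List.ofFn fun j => ZMod.val (y j)) (List.ofFn ω))
      have hcast : (fun t => (((List.ofFn fun j => ZMod.val (y j)).getD t 0 : ℕ) :
          AdjoinRoot (justesenPoly d)))
          = fun t => algebraMap (ZMod 2) (AdjoinRoot (justesenPoly d)) (letter y t) := by
        funext t
        rw [hget, ← map_natCast (algebraMap (ZMod 2) _), ZMod.natCast_zmod_val]
      rw [hcast] at hτ
      exact ⟨τ, hr, hτ⟩
    · intro y hy ω
      rw [hC] at hy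
      obtain ⟨h1, h2⟩ := mem_blockCode.1 hy
      refine ⟨h1, ?_⟩
      simp only [Finset.mul_sum, mul_pow]
      rw [Finset.sum_comm]
      refine Finset.sum_eq_zero fun i hi => ?_
      have := h2 i (Finset.mem_range.1 hi)
      simp only [mul_left_comm (blockMap _ _ _ _ y), ← Finset.mul_sum, this, mul_zero]
    · intro y hy
      rw [hC] at hy
      by_cases h1 : ∀ j < N, blockMap n d (AdjoinRoot.root (justesenPoly d)) (2 * d * j + d) y
          = blockMap n d (AdjoinRoot.root (justesenPoly d)) (2 * d * j) y
            * digitSum (AdjoinRoot.root (justesenPoly d)) 2 d j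
      · have h2 : ¬ ∀ i < N / 4, ∑ j ∈ Finset.range N,
            blockMap n d (AdjoinRoot.root (justesenPoly d)) (2 * d * j) y
              * digitSum (AdjoinRoot.root (justesenPoly d)) 2 d j ^ i = 0 :=
          fun h => hy (mem_blockCode.2 ⟨h1, h⟩)
        push Not at h2
        have hlt : ∀ ω : Fin d → Bool, coinNumber (List.ofFn ω) < 2 ^ d := fun ω =>
          (coinNumber_lt _).trans_le (by simp)
        have h := ncard_random_check_le
          (g := fun ω : Fin d → Bool =>
            digitSum (AdjoinRoot.root (justesenPoly d)) 2 d (coinNumber (List.ofFn ω)))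
          (fun ω ω' h => coinNumber_ofFn_injective _ (justesenPoly_inj d le_rfl
            (by simpa using hlt ω) (by simpa using hlt ω') h)) h2
        -- Only the random check is counted; at most `N / 4 ≤ 2 ^ d / 4` points pass it.
        refine (Nat.mul_le_mul_left 2 ((Set.ncard_le_ncard (fun ω hω => hω.2)
          (Set.toFinite _)).trans h)).trans ?_
        omega
      -- A violated block relation leads to rejection for all coins.
      · simp [h1]

end Justesen

theorem mainTheorem3 :
    -- alphabet size `q = 2`
    (∃ R δ : ℝ, 0 < R ∧ 0 < δ ∧
      ∃ (C : (n : ℕ) → Submodule (ZMod 2) (Fin n → ZMod 2))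
        (k : ℕ) (P : StreamProg (k + 1)) (K : ℕ),
        ∀ n : ℕ, 1 ≤ n →
          HasRateDist R δ (C n) ∧
          IsErrorDetector P [n] ZMod.val (C n : Set (Fin n → ZMod 2))
            1 (K * (Nat.log 2 n + 1)) 1 (1 / 2)) ∧
    -- alphabet sizes `n ≤ q ≤ poly(n)`, where `𝔽_q = 𝔽_p[X]/(f)` and `q = p ^ deg f`
    (∃ R δ : ℝ, 0 < R ∧ 0 < δ ∧
      ∃ (C : (n p : ℕ) → (f : Polynomial (ZMod p)) →
          Submodule (AdjoinRoot f) (Fin n → AdjoinRoot f))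
        (k : ℕ) (P : StreamProg (k + 1)), ∀ c : ℕ, ∃ K : ℕ,
        ∀ n : ℕ, 1 ≤ n → ∀ p : ℕ, p.Prime →
          ∀ (f : Polynomial (ZMod p)) (hf : f.Monic), Irreducible f →
          n ≤ p ^ f.natDegree → p ^ f.natDegree ≤ c * n ^ c →
          HasRateDist R δ (C n p f) ∧
          IsErrorDetector P [n, p, polyCode f] (fieldCode hf)
            (C n p f : Set (Fin n → AdjoinRoot f))
            1 (K * (Nat.log 2 n + 1)) 1 (1 / 2)) := by
  refine ⟨⟨1 / 8, 1 / 2 ^ 40, by norm_num, by norm_num, justesenCode, 23, justesenDetector, 48,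
    fun n hn => ⟨justesenCode_hasRateDist, justesenDetector_isErrorDetector hn⟩⟩,
    1 / 4, 1 / 4, by norm_num, by norm_num, reedSolomonCode, 23, reedSolomonDetector,
    fun c => ⟨24 * (4 * c + 1), fun n hn p hp f hf hi hnq hq =>
      ⟨reedSolomonCode_hasRateDist hp hf hi hnq,
        reedSolomonDetector_isErrorDetector hn hp hf hi hnq hq⟩⟩⟩
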